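/- All graphs are finite and simple. A cut vertex of a graph $H$ is a vertex whose removal increases the number of connected components of $H$; a block of $G$ is a maximal connected subgraph of $G$ that has no cut vertex of its own; a block is biconnected if it has at least three vertices. For $r,k\ge 2$, $\varTheta_r^k$ is the graph consisting of two vertices $u_0,u_k$ joined by $r$ internally vertex-disjoint paths of length $k$, that is, the graph with vertices $u_0$, $u_k$ and $u_{i,j}$ and edges $\{u_0,u_{i,1}\}$, $\{u_{i,j},u_{i,j+1}\}$ (for $1\le j\le k-2$) and $\{u_{i,k-1},u_k\}$, where $1\le i\le r$ and, for the vertices $u_{i,j}$, $1\le j\le k-1$. A 2-clique sum of two graphs $G_1$ and $G_2$ is a graph formed from their disjoint union by identifying an edge of $G_1$ with an edge of $G_2$ to form a single shared edge. For fixed $k$, a graph is called a 2-clique sum of $\varTheta_r^k$ graphs if it is isomorphic to a graph obtained from finitely many (at least one) graphs $\varTheta_{r_1}^k,\dots,\varTheta_{r_m}^k$ (where $r_1,\dots,r_m\ge 2$ may differ) by successive 2-clique sums. **Theorem.** Let $k\ge 3$ and let $G$ be a graph. Then all chordless cycles of $G$ have length $2k$ if and only if every biconnected block of $G$ is a 2-clique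 sum of $\varTheta_r^k$ graphs. -/

import Mathlib

namespace SimpleGraph

universe u v w

/-- `v` is a cut vertex of `G`: two other vertices lying in the same connected component of `G`
lie in different connected components of `G - v`. -/
def IsCutVertex {V : Type u} (G : SimpleGraph V) (v : V) : Prop :=
  ∃ (x y : V) (hx : x ≠ v) (hy : y ≠ v),
    G.Reachable x y ∧ ¬ (G.induce {z : V | z ≠ v}).Reachable ⟨x, hx⟩ ⟨y, hy⟩

/-- A block of `G`: a subgraph that is maximal among the connected subgraphs of `G` that have no
cut vertex (of their own). -/
def IsBlock {V : Type u} (G : SimpleGraph V) (B : G.Subgraph) : Prop :=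
  Maximal (fun H : G.Subgraph => H.coe.Connected ∧ ∀ v : H.verts, ¬ H.coe.IsCutVertex v) B

/-- A biconnected graph: connected, without cut vertices, and with at least three vertices
(so neither a single vertex nor a single edge). -/
def IsBiconnected {V : Type u} (G : SimpleGraph V) : Prop :=
  G.Connected ∧ (∀ v : V, ¬ G.IsCutVertex v) ∧
    ∃ a b c : V, a ≠ b ∧ a ≠ c ∧ b ≠ c

/-- The vertices of the theta graph: the two base points `u_0` and `u_k`, and the internal
vertices `u_{i,j+1}` of the `r` paths, for `i < r` and `j < k - 1`. -/
inductive ThetaVertex (r k : ℕ) : Type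
  | first : ThetaVertex r k
  | last : ThetaVertex r k
  | inner (i : Fin r) (j : Fin (k - 1)) : ThetaVertex r k

/-- The edges of the theta graph, each in the direction from `u_0` to `u_k`. -/
inductive ThetaStep (r k : ℕ) : ThetaVertex r k → ThetaVertex r k → Prop
  | start (i : Fin r) (j : Fin (k - 1)) (h : (j : ℕ) = 0) :
      ThetaStep r k .first (.inner i j)
  | step (i : Fin r) (j j' : Fin (k - 1)) (h : (j' : ℕ) = j + 1) :
      ThetaStep r k (.inner i j) (.inner i j')
  | finish (i : Fin r) (j : Fin (k - 1)) (h : (j : ℕ) + 1 = k - 1) :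
      ThetaStep r k (.inner i j) .last

/-- The theta graph `Θ_r^k`, used for `r, k ≥ 2`: two vertices joined by `r` internally disjoint
paths of length `k`. -/
def thetaGraph (r k : ℕ) : SimpleGraph (ThetaVertex r k) :=
  SimpleGraph.fromRel (ThetaStep r k)

/-- `G` is (up to isomorphism) a 2-clique sum of `G₁` and `G₂`: it is the quotient of their
disjoint union that identifies an edge `a₁b₁` of `G₁` with an edge `a₂b₂` of `G₂`
(`a₁` with `a₂`, `b₁` with `b₂`, and nothing else). -/
def IsTwoCliqueSum {V₁ : Type u} {V₂ : Type v} {V : Type w}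
    (G₁ : SimpleGraph V₁) (G₂ : SimpleGraph V₂) (G : SimpleGraph V) : Prop :=
  ∃ (a₁ b₁ : V₁) (a₂ b₂ : V₂) (π : V₁ ⊕ V₂ → V),
    G₁.Adj a₁ b₁ ∧ G₂.Adj a₂ b₂ ∧
    Function.Surjective π ∧
    (∀ x y : V₁, π (.inl x) = π (.inl y) ↔ x = y) ∧
    (∀ x y : V₂, π (.inr x) = π (.inr y) ↔ x = y) ∧
    (∀ (x : V₁) (y : V₂), π (.inl x) = π (.inr y) ↔ (x = a₁ ∧ y = a₂) ∨ (x = b₁ ∧ y = b₂)) ∧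
    (∀ s t : V, G.Adj s t ↔ ∃ x y : V₁ ⊕ V₂, (G₁ ⊕g G₂).Adj x y ∧ π x = s ∧ π y = t)

/-- `G` is obtained from finitely many (at least one) theta graphs `Θ_r^k`, with `k` fixed and
`r ≥ 2` allowed to vary, by successive 2-clique sums. -/
inductive IsThetaCliqueSum (k : ℕ) : {V : Type u} → SimpleGraph V → Prop
  | theta {V : Type u} (G : SimpleGraph V) (r : ℕ) (hr : 2 ≤ r)
      (hG : Nonempty (G ≃g thetaGraph r k)) : IsThetaCliqueSum k G
  | sum {V₁ V₂ V : Type u} (G₁ : SimpleGraph V₁) (G₂ : SimpleGraph V₂) (G : SimpleGraph V)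
      (h₁ : IsThetaCliqueSum k G₁) (h₂ : IsThetaCliqueSum k G₂)
      (hG : IsTwoCliqueSum G₁ G₂ G) : IsThetaCliqueSum k G

end SimpleGraph

/-! Call a chordless cycle a hole. Every hole lies in a biconnected block (`IsHoleSeq.exists_block`)
and biconnected blocks are induced (`IsBlock.adj_iff`), so both directions reduce to graphs without
cut vertices.

Suppose all holes have length 2k. If the ends of some edge separate the graph, cut along it: both
sides are smaller, still have no cut vertex, and induction applies. If no edge separates, the graph
is a single theta graph. To see this, take an induced theta with as many branches as possible; a
hole provides one with two branches. If it misses a vertex, then some path outside it joins two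
nonadjacent vertices of it, an ear (`AvoidsEdges.exists_isEar`): otherwise the attachments of an
outside component form a clique, hence lie in an edge because there are no triangles, and that edge
separates.

Take a shortest ear. Minimality allows extra chords to the theta only at a common neighbour of the
ear's ends. As 2k ≥ 6 there are no 4-cycles, so this neighbour is unique; it would have to lie on
both arcs of a hole through the two ends, which is impossible (`IsEar.antipodal`). The ear therefore
closes each of the two arcs to a hole of length 2k, which forces the ear and both arcs to have
length k. Such an ear is a new branch (`IsTheta.exists_extension`): with two branches any antipodal
pair can serve as base points, while with three or more a detour through a third branch gives too
long a hole unless the ends are the base points already. This contradicts maximality.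

Conversely, a hole of a 2-clique sum cannot cross the shared edge (`IsHoleSeq.subset_side`), and a
hole of a theta graph is the union of two branches (`IsTheta.allHoles`). -/

namespace SimpleGraph

/-! ### Cycles, holes and induced paths as sequences -/

/-- The first `n` terms of `C` are the vertices, in cyclic order, of a cycle of `G`. -/
structure IsCycleSeq {V : Type*} (G : SimpleGraph V) (n : ℕ) (C : ℕ → V) : Prop where
  inj : ∀ x y, x < n → y < n → C x = C y → x = y
  adj : ∀ x, x + 1 < n → G.Adj (C x) (C (x + 1))
  close : G.Adj (C (n - 1)) (C 0)

/-- The first `n` terms of `C` are the vertices, in cyclic order, of a chordless cycle of `G`. -/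
def IsHoleSeq {V : Type*} (G : SimpleGraph V) (n : ℕ) (C : ℕ → V) : Prop :=
  ∀ x y, x < n → y < n → (C x = C y → x = y) ∧
    (G.Adj (C x) (C y) ↔ x + 1 = y ∨ y + 1 = x ∨ (x = 0 ∧ y + 1 = n) ∨ (y = 0 ∧ x + 1 = n))

/-- The vertices `P 0, …, P m` form an induced path of `G`. -/
def IsArc {V : Type*} (G : SimpleGraph V) (m : ℕ) (P : ℕ → V) : Prop :=
  ∀ x y, x ≤ m → y ≤ m → (P x = P y → x = y) ∧
    (G.Adj (P x) (P y) ↔ x + 1 = y ∨ y + 1 = x)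

/-- All chordless cycles of `G` have length `2 * k`. -/
def AllHoles {V : Type*} (k : ℕ) (G : SimpleGraph V) : Prop :=
  ∀ n C, 3 ≤ n → G.IsHoleSeq n C → n = 2 * k

/-- `F i 0, …, F i k` for `i < r` are the branches of an induced theta graph of `G`. -/
def IsTheta {V : Type*} (G : SimpleGraph V) (k r : ℕ) (F : ℕ → ℕ → V) : Prop :=
  ∀ i j s t, i < r → j < r → s ≤ k → t ≤ k →
    (F i s = F j t ↔ s = t ∧ (i = j ∨ s = 0 ∨ s = k)) ∧
    (G.Adj (F i s) (F j t) ↔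
      (s + 1 = t ∨ t + 1 = s) ∧ (i = j ∨ s = 0 ∨ s = k ∨ t = 0 ∨ t = k))

/-- A path of length `m` between nonadjacent vertices of `H`, with its interior outside `H`. -/
structure IsEar {V : Type*} (G : SimpleGraph V) (H : Set V) (m : ℕ) (P : ℕ → V) : Prop where
  start_mem : P 0 ∈ H
  end_mem : P m ∈ H
  ne : P 0 ≠ P m
  not_adj : ¬ G.Adj (P 0) (P m)
  interior : ∀ i, 0 < i → i < m → P i ∉ H
  adj : ∀ i, i < m → G.Adj (P i) (P (i + 1))

section
variable {V : Type*} {G : SimpleGraph V} {k : ℕ}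

/-- A chord cuts off a strictly shorter cycle; induct on the length. -/
theorem IsCycleSeq.exists_isHoleSeq {n : ℕ} {C : ℕ → V} (hC : G.IsCycleSeq n C) (hn : 3 ≤ n) :
    ∃ m D, 3 ≤ m ∧ m ≤ n ∧ G.IsHoleSeq m D := by
  induction n using Nat.strong_induction_on generalizing C with
  | _ n ih =>
  by_cases h : ∃ x y, x + 1 < y ∧ y < n ∧ ¬ (x = 0 ∧ y + 1 = n) ∧ G.Adj (C x) (C y)
  · obtain ⟨x, y, hxy, hy, hne, hadj⟩ := h
    obtain ⟨m, D, h3, hm, hD⟩ := ih (y - x + 1) (by omega) (C := fun t => C (x + t))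
      ⟨fun a b ha hb hab => by have := hC.inj _ _ (by omega) (by omega) hab; omega,
        fun a ha => by simpa [add_assoc] using hC.adj (x + a) (by omega),
        by simpa [show x + (y - x) = y by omega] using hadj.symm⟩ (by omega)
    exact ⟨m, D, h3, by omega, hD⟩
  · refine ⟨n, C, hn, le_rfl, fun x y hx hy => ⟨hC.inj x y hx hy, fun hadj => ?_, ?_⟩⟩
    · push Not at h
      rcases lt_trichotomy x y with hxy | rfl | hxy
      · by_contra hcon
        exact h x y (by omega) hy (by omega) hadj
      · exact absurd hadj (G.loopless.irrefl _)
      · by_contra hcon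
        exact h y x (by omega) hx (by omega) hadj.symm
    · rintro (rfl | rfl | ⟨rfl, rfl⟩ | ⟨rfl, rfl⟩)
      · exact hC.adj _ hy
      · exact (hC.adj _ hx).symm
      · simpa using hC.close.symm
      · simpa using hC.close

theorem AllHoles.le_of_isCycleSeq (hG : G.AllHoles k) {n : ℕ} {C : ℕ → V}
    (hC : G.IsCycleSeq n C) (hn : 3 ≤ n) : 2 * k ≤ n := by
  obtain ⟨m, D, h3, hm, hD⟩ := hC.exists_isHoleSeq hn
  have := hG m D h3 hD
  omega

theorem IsArc.reverse {m : ℕ} {P : ℕ → V} (hP : G.IsArc m P) :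
    G.IsArc m (fun x => P (m - x)) := by
  intro x y hx hy
  have := hP (m - x) (m - y) (by omega) (by omega)
  refine ⟨fun h => ?_, this.2.trans ?_⟩
  · have := this.1 h; omega
  · omega

/-- The vertex `z` may have further neighbours on the arc, so the cycle it closes may have chords,
and only an inequality results. -/
theorem AllHoles.le_of_apex (hG : G.AllHoles k) {l : ℕ} {A : ℕ → V} (hA : G.IsArc l A)
    (hl : 1 ≤ l) {z : V} (hz : ∀ x ≤ l, A x ≠ z) (h0 : G.Adj z (A 0)) (h1 : G.Adj z (A l)) :
    2 * k ≤ l + 2 := by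
  refine hG.le_of_isCycleSeq (C := fun x => if x ≤ l then A x else z)
    ⟨fun x y hx hy h => ?_, fun x hx => ?_, ?_⟩ (by omega)
  · split_ifs at h with h2 h3 h3
    · exact (hA x y h2 h3).1 h
    · exact absurd h (hz x h2)
    · exact absurd h.symm (hz y h3)
    · omega
  · split_ifs with h2 h3
    · exact (hA x (x + 1) h2 h3).2.2 (Or.inl rfl)
    · obtain rfl : x = l := by omega
      exact h1.symm
    · omega
    · omega
  · simpa using h0

/-- Go out along `P` and back along `Q`. Lengths at least 2 make the common ends nonadjacent, so
chords could only join the two interiors. -/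
theorem IsArc.isHoleSeq_append {m n : ℕ} {P Q : ℕ → V} (hP : G.IsArc m P) (hQ : G.IsArc n Q)
    (h0 : P 0 = Q 0) (h1 : P m = Q n) (hm : 2 ≤ m) (hn : 2 ≤ n)
    (hne : ∀ i j, 0 < i → i < m → 0 < j → j < n → P i ≠ Q j ∧ ¬ G.Adj (P i) (Q j)) :
    G.IsHoleSeq (m + n) (fun x => if x ≤ m then P x else Q (m + n - x)) := by
  have key : ∀ i j, i ≤ m → 0 < j → j < n →
      P i ≠ Q j ∧ (G.Adj (P i) (Q j) ↔ (i = 0 ∧ j = 1) ∨ (i = m ∧ j + 1 = n)) := by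
    intro i j hi hj hjn
    rcases Nat.eq_zero_or_pos i with rfl | hi0
    · rw [h0]
      have := hQ 0 j (by omega) (by omega)
      refine ⟨fun h => ?_, this.2.trans ?_⟩
      · have := this.1 h; omega
      · omega
    rcases eq_or_lt_of_le hi with rfl | him
    · rw [h1]
      have := hQ n j (by omega) (by omega)
      refine ⟨fun h => ?_, this.2.trans ?_⟩
      · have := this.1 h; omega
      · omega
    · have := hne i j hi0 him hj hjn
      refine ⟨this.1, iff_of_false this.2 (by omega)⟩
  intro x y hx hy
  dsimp only
  split_ifs with h2 h3 h3
  · have := hP x y h2 h3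
    refine ⟨this.1, this.2.trans ?_⟩
    omega
  · have := key x (m + n - y) h2 (by omega) (by omega)
    refine ⟨fun h => absurd h this.1, this.2.trans ?_⟩
    omega
  · have := key y (m + n - x) h3 (by omega) (by omega)
    refine ⟨fun h => absurd h.symm this.1, (G.adj_comm _ _).trans (this.2.trans ?_)⟩
    omega
  · have := hQ (m + n - x) (m + n - y) (by omega) (by omega)
    refine ⟨fun h => ?_, this.2.trans ?_⟩
    · have := this.1 h; omega
    · omega

theorem AllHoles.add_eq (hG : G.AllHoles k) {m n : ℕ} {P Q : ℕ → V} (hP : G.IsArc m P)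
    (hQ : G.IsArc n Q) (h0 : P 0 = Q 0) (h1 : P m = Q n) (hm : 2 ≤ m) (hn : 2 ≤ n)
    (hne : ∀ i j, 0 < i → i < m → 0 < j → j < n → P i ≠ Q j ∧ ¬ G.Adj (P i) (Q j)) :
    m + n = 2 * k :=
  hG _ _ (by omega) (hP.isHoleSeq_append hQ h0 h1 hm hn hne)

theorem AllHoles.not_triangle (hG : G.AllHoles k) (hk : 3 ≤ k) {a b c : V} (hab : G.Adj a b)
    (hbc : G.Adj b c) (hca : G.Adj c a) : False := by
  have := hG.le_of_isCycleSeq (n := 3) (C := fun x => if x = 0 then a else if x = 1 then b else c)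
    ⟨fun x y hx hy h => by
        have := hab.ne; have := hbc.ne; have := hca.ne
        interval_cases x <;> interval_cases y <;> simp_all,
      fun x hx => by
        have : x = 0 ∨ x = 1 := by omega
        rcases this with rfl | rfl <;> simpa, by simpa⟩ le_rfl
  omega

/-- Two common neighbours would give a 4-cycle, too short since 2k ≥ 6. -/
theorem AllHoles.eq_of_common_neighbors (hG : G.AllHoles k) (hk : 3 ≤ k) {a b h h' : V}
    (hab : a ≠ b) (hah : G.Adj a h) (hbh : G.Adj b h) (hah' : G.Adj a h') (hbh' : G.Adj b h') :
    h = h' := by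
  by_contra hne
  have := hG.le_of_isCycleSeq (n := 4)
    (C := fun x => if x = 0 then a else if x = 1 then h else if x = 2 then b else h')
    ⟨fun x y hx hy e => by
        have := hah.ne; have := hbh.ne; have := hah'.ne; have := hbh'.ne
        interval_cases x <;> interval_cases y <;> simp_all,
      fun x hx => by
        have : x = 0 ∨ x = 1 ∨ x = 2 := by omega
        rcases this with rfl | rfl | rfl <;> simp [hah, hbh.symm, hbh'],
      by simpa using hah'.symm⟩ (by omega)
  omega

/-- Together with `isArc_backward`, this splits a hole into two induced paths between two of its
vertices. The length conditions exclude the case where the remaining arc is a single edge, which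
would be a chord. -/
theorem IsHoleSeq.isArc_forward {n : ℕ} {C : ℕ → V} (hC : G.IsHoleSeq n C) {x y : ℕ}
    (hxy : x < y) (hy : y < n) (hlt : y - x + 1 < n) : G.IsArc (y - x) (fun t => C (x + t)) := by
  intro s t hs ht
  have := hC (x + s) (x + t) (by omega) (by omega)
  refine ⟨fun h => ?_, this.2.trans ?_⟩
  · have := this.1 h; omega
  · omega

/-- The vertex `t` steps before the vertex with index `x` on a cyclic sequence of length `n`. -/
def backward (n x : ℕ) (C : ℕ → V) (t : ℕ) : V :=
  if t ≤ x then C (x - t) else C (n + x - t)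

theorem IsHoleSeq.isArc_backward {n : ℕ} {C : ℕ → V} (hC : G.IsHoleSeq n C) {x y : ℕ}
    (hxy : x + 1 < y) (hy : y < n) : G.IsArc (n - (y - x)) (backward n x C) := by
  intro s t hs ht
  unfold backward
  split_ifs with h2 h3 h3
  · have := hC (x - s) (x - t) (by omega) (by omega)
    refine ⟨fun h => ?_, this.2.trans ?_⟩
    · have := this.1 h; omega
    · omega
  · have := hC (x - s) (n + x - t) (by omega) (by omega)
    refine ⟨fun h => ?_, this.2.trans ?_⟩
    · have := this.1 h; omega
    · omega
  · have := hC (n + x - s) (x - t) (by omega) (by omega)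
    refine ⟨fun h => ?_, this.2.trans ?_⟩
    · have := this.1 h; omega
    · omega
  · have := hC (n + x - s) (n + x - t) (by omega) (by omega)
    refine ⟨fun h => ?_, this.2.trans ?_⟩
    · have := this.1 h; omega
    · omega

theorem IsHoleSeq.forward_ne_backward {n : ℕ} {C : ℕ → V} (hC : G.IsHoleSeq n C) {x y : ℕ}
    (hxy : x < y) (hy : y < n) {s t : ℕ} (hs : s ≤ y - x) (ht : t ≤ n - (y - x))
    (h : C (x + s) = backward n x C t) :
    (s = 0 ∧ t = 0) ∨ (s = y - x ∧ t = n - (y - x)) := by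
  unfold backward at h
  split_ifs at h
  · have := (hC (x + s) (x - t) (by omega) (by omega)).1 h
    omega
  · have := (hC (x + s) (n + x - t) (by omega) (by omega)).1 h
    omega

theorem IsHoleSeq.forward_not_adj_backward {n : ℕ} {C : ℕ → V} (hC : G.IsHoleSeq n C) {x y : ℕ}
    (hxy : x < y) (hy : y < n) {s t : ℕ} (hs : 0 < s) (hs' : s < y - x) (ht : 0 < t)
    (ht' : t < n - (y - x)) : ¬ G.Adj (C (x + s)) (backward n x C t) := by
  unfold backward
  split_ifs
  · rw [(hC (x + s) (x - t) (by omega) (by omega)).2]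
    omega
  · rw [(hC (x + s) (n + x - t) (by omega) (by omega)).2]
    omega

end

/-! ### Shortest ears -/

section
variable {V : Type*} {G : SimpleGraph V} {k : ℕ} {H : Set V}

theorem IsEar.reverse {m : ℕ} {P : ℕ → V} (hP : G.IsEar H m P) :
    G.IsEar H m (fun x => P (m - x)) where
  start_mem := by simpa using hP.end_mem
  end_mem := by simpa using hP.start_mem
  ne := by simpa using hP.ne.symm
  not_adj := by simpa [G.adj_comm] using hP.not_adj
  interior i h0 h1 := hP.interior _ (by omega) (by omega)
  adj i hi := by
    have := hP.adj (m - (i + 1)) (by omega)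
    rw [show m - (i + 1) + 1 = m - i by omega] at this
    exact this.symm

theorem IsEar.two_le {m : ℕ} {P : ℕ → V} (hP : G.IsEar H m P) : 2 ≤ m := by
  by_contra h
  have : m = 0 ∨ m = 1 := by omega
  rcases this with rfl | rfl
  · exact hP.ne rfl
  · exact hP.not_adj (hP.adj 0 one_pos)

theorem IsEar.isArc {m : ℕ} {P : ℕ → V} (hP : G.IsEar H m P)
    (hmin : ∀ m' P', G.IsEar H m' P' → m ≤ m') : G.IsArc m P := by
  -- Repetitions (`d = 0`) and chords (`d = 1`) are treated together: jumping from position `i` to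
  -- position `j` shortens the ear by `j - i - d`.
  have shortcut : ∀ i j, i < j → j ≤ m → ∀ d, (d = 0 ∧ P i = P j ∨ d = 1 ∧ G.Adj (P i) (P j)) →
      j ≤ i + d := by
    intro i j hij hj d hd
    by_contra hcon
    have hne : ¬ (i = 0 ∧ j = m) := by
      rintro ⟨rfl, rfl⟩
      rcases hd with hd | hd
      · exact hP.ne hd.2
      · exact hP.not_adj hd.2
    have him : i < m := by omega
    have hadj : ∀ x, x = i → G.Adj (P x) (P (x + 1 + (j - i - d))) := by
      rintro x rfl
      rcases hd with ⟨rfl, hd⟩ | ⟨rfl, hd⟩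
      · have hjm : j < m := by
          refine lt_of_le_of_ne hj fun h => ?_
          rcases Nat.eq_zero_or_pos x with h0 | h0
          · omega
          · exact hP.interior x h0 him (hd ▸ h ▸ hP.end_mem)
        rw [hd, show x + 1 + (j - x - 0) = j + 1 by omega]
        exact hP.adj j hjm
      · rwa [show x + 1 + (j - x - 1) = j by omega]
    have hend : (if m - (j - i - d) ≤ i then P (m - (j - i - d))
        else P (m - (j - i - d) + (j - i - d))) = P m := by
      split_ifs with h
      · rcases hd with ⟨rfl, hd⟩ | ⟨rfl, hd⟩
        · rw [show m - (j - i - 0) = i by omega, hd, show j = m by omega]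
        · omega
      · congr 1; omega
    have := hmin (m - (j - i - d)) (fun x => if x ≤ i then P x else P (x + (j - i - d)))
      { start_mem := by simpa using hP.start_mem
        end_mem := by rw [hend]; exact hP.end_mem
        ne := by rw [hend]; simpa using hP.ne
        not_adj := by rw [hend]; simpa using hP.not_adj
        interior := fun x h0 h1 => by
          split_ifs
          · exact hP.interior x h0 (by omega)
          · exact hP.interior _ (by omega) (by omega)
        adj := fun x hx => by
          split_ifs with h1 h2 h2
          · exact hP.adj x (by omega)
          · exact hadj x (by omega)
          · omega
          · rw [add_right_comm]
            exact hP.adj _ (by omega) }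
    omega
  intro x y hx hy
  rcases lt_trichotomy x y with hxy | rfl | hxy
  · refine ⟨fun h => ?_, fun h => ?_, ?_⟩
    · have := shortcut x y hxy hy 0 (Or.inl ⟨rfl, h⟩); omega
    · have := shortcut x y hxy hy 1 (Or.inr ⟨rfl, h⟩); omega
    · rintro (rfl | rfl)
      · exact hP.adj _ hy
      · exact (hP.adj _ hx).symm
  · simp
  · refine ⟨fun h => ?_, fun h => ?_, ?_⟩
    · have := shortcut y x hxy hx 0 (Or.inl ⟨rfl, h.symm⟩); omega
    · have := shortcut y x hxy hx 1 (Or.inr ⟨rfl, h.symm⟩); omega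
    · rintro (rfl | rfl)
      · exact hP.adj _ hy
      · exact (hP.adj _ hx).symm

/-- Stopping at `P i` and stepping to `h` would give a shorter ear, unless `h` fails to be a legal
end for an ear starting at `P 0`. -/
theorem IsEar.chord_left {m : ℕ} {P : ℕ → V} (hP : G.IsEar H m P)
    (hmin : ∀ m' P', G.IsEar H m' P' → m ≤ m') {i : ℕ} (h0 : 0 < i) (h1 : i + 1 < m) {h : V}
    (hh : h ∈ H) (hadj : G.Adj (P i) h) : h = P 0 ∨ G.Adj (P 0) h := by
  by_contra hcon
  push Not at hcon
  have := hmin (i + 1) (fun x => if x ≤ i then P x else h)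
    { start_mem := by simpa using hP.start_mem
      end_mem := by simpa using hh
      ne := by simpa using hcon.1.symm
      not_adj := by simpa using hcon.2
      interior := fun x h0 hx => by
        rw [if_pos (by omega)]
        exact hP.interior x h0 (by omega)
      adj := fun x hx => by
        rw [if_pos (by omega)]
        split_ifs with h2
        · exact hP.adj x (by omega)
        · obtain rfl : x = i := by omega
          exact hadj }
  omega

/-- Truncation is applied from both ends of the ear. Absence of triangles rules out a common
neighbour attached to the first or last interior vertex. -/
theorem IsEar.chord {m : ℕ} {P : ℕ → V} (hP : G.IsEar H m P)
    (hmin : ∀ m' P', G.IsEar H m' P' → m ≤ m') (hG : G.AllHoles k) (hk : 3 ≤ k) (hm : 3 ≤ m)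
    {i : ℕ} (h0 : 0 < i) (h1 : i < m) {h : V} (hh : h ∈ H) (hadj : G.Adj (P i) h) :
    (i = 1 ∧ h = P 0) ∨ (i + 1 = m ∧ h = P m) ∨ (G.Adj (P 0) h ∧ G.Adj (P m) h) := by
  have harc := hP.isArc hmin
  have hl : i + 1 < m → (i = 1 ∧ h = P 0) ∨ (1 < i ∧ G.Adj (P 0) h) := by
    intro him
    rcases hP.chord_left hmin h0 him hh hadj with rfl | h2
    · have := (harc i 0 (by omega) (by omega)).2.1 hadj
      exact Or.inl ⟨by omega, rfl⟩
    · refine Or.inr ⟨lt_of_le_of_ne h0 fun e => ?_, h2⟩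
      subst e
      exact hG.not_triangle hk (hP.adj 0 (by omega)) hadj h2.symm
  have hr : 1 < i → (i + 1 = m ∧ h = P m) ∨ (i + 1 < m ∧ G.Adj (P m) h) := by
    intro hi
    have := hP.reverse.chord_left hmin (i := m - i) (by omega) (by omega) hh
      (by simpa [show m - (m - i) = i by omega] using hadj)
    simp only [Nat.sub_zero] at this
    rcases this with rfl | h2
    · have := (harc i m (by omega) (by omega)).2.1 hadj
      exact Or.inl ⟨by omega, rfl⟩
    · refine Or.inr ⟨lt_of_le_of_ne h1 fun e => ?_, h2⟩
      subst e
      exact hG.not_triangle hk (hP.adj i (by omega)) h2 hadj.symm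
  rcases lt_or_ge (i + 1) m with him | him
  · rcases hl him with h2 | h2
    · exact Or.inl h2
    · rcases hr h2.1 with h3 | h3
      · exact Or.inr (Or.inl h3)
      · exact Or.inr (Or.inr ⟨h2.2, h3.2⟩)
  · rcases hr (by omega) with h3 | h3
    · exact Or.inr (Or.inl h3)
    · omega

/-- A path with interior outside `H` without chords towards `H`. -/
def NoChord {V : Type*} (G : SimpleGraph V) (H : Set V) (m : ℕ) (P : ℕ → V) : Prop :=
  ∀ i, 0 < i → i < m → P i ∉ H ∧
    ∀ h ∈ H, G.Adj (P i) h → (i = 1 ∧ h = P 0) ∨ (i + 1 = m ∧ h = P m)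

theorem NoChord.reverse {m : ℕ} {P : ℕ → V} (hP : G.NoChord H m P) :
    G.NoChord H m (fun x => P (m - x)) := by
  intro i h0 h1
  refine ⟨(hP (m - i) (by omega) (by omega)).1, fun h hh hadj => ?_⟩
  rcases (hP (m - i) (by omega) (by omega)).2 h hh hadj with h2 | h2
  · exact Or.inr ⟨by omega, by simpa using h2.2⟩
  · exact Or.inl ⟨by omega, by simpa using h2.2⟩

theorem NoChord.add_eq {m l : ℕ} {P A : ℕ → V} (hP : G.NoChord H m P) (hG : G.AllHoles k)
    (harc : G.IsArc m P) (hA : G.IsArc l A) (hAH : ∀ x ≤ l, A x ∈ H) (h0 : P 0 = A 0)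
    (h1 : P m = A l) (hm : 2 ≤ m) (hl : 2 ≤ l) : m + l = 2 * k := by
  refine hG.add_eq harc hA h0 h1 hm hl fun i j hi him hj hjl => ?_
  have := hP i hi him
  refine ⟨fun e => this.1 (e ▸ hAH j hjl.le), fun hadj => ?_⟩
  rcases this.2 _ (hAH j hjl.le) hadj with h2 | h2
  · have := (hA j 0 (by omega) (by omega)).1 (h2.2.trans h0); omega
  · have := (hA j l (by omega) (by omega)).1 (h2.2.trans h1); omega

/-- The common neighbour `h` of the ends of a shortest ear cannot lie outside an arc of `H`
joining these ends. -/
theorem IsEar.mem_arc {m l : ℕ} {P A : ℕ → V} (hP : G.IsEar H m P)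
    (hmin : ∀ m' P', G.IsEar H m' P' → m ≤ m') (hG : G.AllHoles k) (hk : 3 ≤ k) (hm : 3 ≤ m)
    (hA : G.IsArc l A) (hAH : ∀ x ≤ l, A x ∈ H) (h0 : P 0 = A 0)
    (h1 : P m = A l) (hl : 2 ≤ l) {h : V} (ha : G.Adj (P 0) h) (hb : G.Adj (P m) h) :
    ∃ x ≤ l, A x = h := by
  by_contra hcon
  push Not at hcon
  -- The apex `h` forces `l + 2 ≥ 2 * k`. A chord between ear and arc would end at a common
  -- neighbour of the ends, that is, at `h`, which is off the arc; so ear and arc form a hole and `m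
  -- + l = 2 * k`. This contradicts `m ≥ 3`.
  have h2 := hG.le_of_apex hA (by omega) hcon (h0 ▸ ha.symm) (h1 ▸ hb.symm)
  have h3 := hG.add_eq (hP.isArc hmin) hA h0 h1 (by omega) hl fun i j hi him hj hjl => by
    refine ⟨fun e => hP.interior i hi him (e ▸ hAH j hjl.le), fun hadj => ?_⟩
    rcases hP.chord hmin hG hk hm hi him (hAH j hjl.le) hadj with h2 | h2 | h2
    · have := (hA j 0 (by omega) (by omega)).1 (h2.2.trans h0); omega
    · have := (hA j l (by omega) (by omega)).1 (h2.2.trans h1); omega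
    · exact hcon j hjl.le (hG.eq_of_common_neighbors hk hP.ne h2.1 h2.2 ha hb)
  omega

/-- Once chords are excluded, the ear forms a hole with each of the two arcs of `C`, and the two
length equations leave only `k` for all three paths. -/
theorem IsEar.antipodal {m : ℕ} {P C : ℕ → V} (hP : G.IsEar H m P)
    (hmin : ∀ m' P', G.IsEar H m' P' → m ≤ m') (hG : G.AllHoles k) (hk : 3 ≤ k)
    (hC : G.IsHoleSeq (2 * k) C) (hCH : ∀ x < 2 * k, C x ∈ H) {x y : ℕ} (hxy : x < y)
    (hy : y < 2 * k) (h0 : P 0 = C x) (h1 : P m = C y) :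
    m = k ∧ y = x + k ∧ G.NoChord H m P := by
  have hna := hP.not_adj
  rw [h0, h1, (hC x y (by omega) hy).2] at hna
  have hA := hC.isArc_forward hxy hy (by omega)
  have hB := hC.isArc_backward (x := x) (y := y) (by omega) hy
  have hAH : ∀ t ≤ y - x, C (x + t) ∈ H := fun t ht => hCH _ (by omega)
  have hBH : ∀ t ≤ 2 * k - (y - x), backward (2 * k) x C t ∈ H := fun t ht => by
    unfold backward
    split_ifs
    · exact hCH _ (by omega)
    · exact hCH _ (by omega)
  have hA0 : P 0 = C (x + 0) := by simpa using h0
  have hA1 : P m = C (x + (y - x)) := by rw [show x + (y - x) = y by omega, h1]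
  have hB0 : P 0 = backward (2 * k) x C 0 := by simpa [backward] using h0
  have hB1 : P m = backward (2 * k) x C (2 * k - (y - x)) := by
    unfold backward
    rw [if_neg (by omega), h1]
    congr 1; omega
  have h2 := hP.two_le
  -- For an ear of length 2, its middle vertex is an apex over both arcs, so both have length at
  -- least `2 * k - 2`; they add up to `2 * k`, which is too little.
  have hm : 3 ≤ m := by
    by_contra hcon
    obtain rfl : m = 2 := by omega
    have hadj0 := (hP.adj 0 (by omega)).symm
    have hadj1 := hP.adj 1 (by omega)
    have hint := hP.interior 1 (by omega) (by omega)
    have ha := hG.le_of_apex hA (by omega) (z := P 1) (fun t ht e => hint (e ▸ hAH t ht))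
      (hA0 ▸ hadj0) (hA1 ▸ hadj1)
    have hb := hG.le_of_apex hB (by omega) (z := P 1) (fun t ht e => hint (e ▸ hBH t ht))
      (hB0 ▸ hadj0) (hB1 ▸ hadj1)
    omega
  have hno : G.NoChord H m P := by
    refine fun i hi him => ⟨hP.interior i hi him, fun h hh hadj => ?_⟩
    rcases hP.chord hmin hG hk hm hi him hh hadj with h2 | h2 | ⟨ha, hb⟩
    · exact Or.inl h2
    · exact Or.inr h2
    -- The common neighbour lies on both arcs, which meet only in the ends of the ear.
    · exfalso
      obtain ⟨s, hs, hs'⟩ := hP.mem_arc hmin hG hk hm hA hAH hA0 hA1 (by omega) ha hb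
      obtain ⟨t, ht, ht'⟩ := hP.mem_arc hmin hG hk hm hB hBH hB0 hB1 (by omega) ha hb
      rcases hC.forward_ne_backward hxy hy hs ht (hs'.trans ht'.symm) with h2 | h2
      · rw [h2.1, ← hA0] at hs'
        exact ha.ne hs'
      · rw [h2.1, ← hA1] at hs'
        exact hb.ne hs'
  have ha := hno.add_eq hG (hP.isArc hmin) hA hAH hA0 hA1 h2 (by omega)
  have hb := hno.add_eq hG (hP.isArc hmin) hB hBH hB0 hB1 h2 (by omega)
  exact ⟨by omega, by omega, hno⟩

end

/-! ### Induced theta graphs and their extension by an ear -/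

section
variable {V : Type*} {G : SimpleGraph V} {k : ℕ} {H : Set V}

/-- The vertices of the branches `F 0, …, F (r - 1)`. -/
def branchSet {V : Type*} (k r : ℕ) (F : ℕ → ℕ → V) : Set V :=
  {z | ∃ i s, i < r ∧ s ≤ k ∧ F i s = z}

theorem IsTheta.isArc {r : ℕ} {F : ℕ → ℕ → V} (hF : G.IsTheta k r F) {i : ℕ} (hi : i < r) :
    G.IsArc k (F i) := by
  intro s t hs ht
  have := hF i i s t hi hi hs ht
  exact ⟨fun h => (this.1.1 h).1, by simpa using this.2⟩

theorem isTheta_of_isArc {r : ℕ} {F : ℕ → ℕ → V} (hk : 2 ≤ k) (hF : ∀ i < r, G.IsArc k (F i))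
    (h0 : ∀ i < r, F i 0 = F 0 0) (h1 : ∀ i < r, F i k = F 0 k)
    (h : ∀ i j s t, i < r → j < r → i ≠ j → 0 < s → s < k → 0 < t → t < k →
      F i s ≠ F j t ∧ ¬ G.Adj (F i s) (F j t)) : G.IsTheta k r F := by
  intro i j s t hi hj hs ht
  rcases eq_or_ne i j with rfl | hij
  · have := hF i hi s t hs ht
    refine ⟨⟨fun h => ⟨this.1 h, Or.inl rfl⟩, fun h => by rw [h.1]⟩, this.2.trans (by simp)⟩
  have h0' : F i 0 = F j 0 := (h0 i hi).trans (h0 j hj).symm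
  have h1' : F i k = F j k := (h1 i hi).trans (h1 j hj).symm
  have aux : ∀ s, s = 0 ∨ s = k → F i s = F j s := by
    rintro s (rfl | rfl)
    · exact h0'
    · exact h1'
  by_cases hs' : s = 0 ∨ s = k
  · rw [aux s hs']
    have := hF j hj s t hs ht
    refine ⟨⟨fun h => ⟨this.1 h, Or.inr hs'⟩, fun h => by rw [h.1]⟩, this.2.trans (by tauto)⟩
  by_cases ht' : t = 0 ∨ t = k
  · rw [← aux t ht']
    have := hF i hi s t hs ht
    refine ⟨⟨fun h => ?_, fun h => by rw [h.1]⟩, this.2.trans (by tauto)⟩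
    obtain rfl := this.1 h
    exact absurd ht' hs'
  · have := h i j s t hi hj hij (by omega) (by omega) (by omega) (by omega)
    exact ⟨iff_of_false this.1 (by tauto), iff_of_false this.2 (by tauto)⟩

/-- The cycle formed by the branches `i` and `j`. -/
def thetaCycle {V : Type*} (k : ℕ) (F : ℕ → ℕ → V) (i j x : ℕ) : V :=
  if x ≤ k then F i x else F j (2 * k - x)

theorem IsTheta.isHoleSeq {r : ℕ} {F : ℕ → ℕ → V} (hF : G.IsTheta k r F) (hk : 2 ≤ k) {i j : ℕ}
    (hi : i < r) (hj : j < r) (hij : i ≠ j) : G.IsHoleSeq (2 * k) (thetaCycle k F i j) := by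
  intro x y hx hy
  unfold thetaCycle
  split_ifs
  · have := hF i i x y hi hi (by omega) (by omega)
    rw [this.1, this.2]
    omega
  · have := hF i j x (2 * k - y) hi hj (by omega) (by omega)
    rw [this.1, this.2]
    omega
  · have := hF j i (2 * k - x) y hj hi (by omega) (by omega)
    rw [this.1, this.2]
    omega
  · have := hF j j (2 * k - x) (2 * k - y) hj hj (by omega) (by omega)
    rw [this.1, this.2]
    omega

theorem thetaCycle_mem {r : ℕ} {F : ℕ → ℕ → V} {i j x : ℕ} (hi : i < r) (hj : j < r)
    (hx : x < 2 * k) : thetaCycle k F i j x ∈ branchSet k r F := by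
  unfold thetaCycle
  split_ifs
  · exact ⟨i, x, hi, by omega, rfl⟩
  · exact ⟨j, 2 * k - x, hj, by omega, rfl⟩

/-- The position on `thetaCycle k F i j` of the vertex `F j t`. -/
def secondIndex (k t : ℕ) : ℕ := if t = 0 then 0 else 2 * k - t

theorem IsTheta.thetaCycle_secondIndex {r : ℕ} {F : ℕ → ℕ → V} (hF : G.IsTheta k r F)
    {i j t : ℕ} (hi : i < r) (hj : j < r) (ht : t ≤ k) :
    thetaCycle k F i j (secondIndex k t) = F j t := by
  unfold thetaCycle secondIndex
  split_ifs with h1 h2 h2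
  · rw [h1]; exact ((hF i j 0 0 hi hj (by omega) (by omega)).1).2 ⟨rfl, by simp⟩
  · omega
  · obtain rfl : t = k := by omega
    rw [show 2 * t - t = t by omega]
    exact ((hF i j t t hi hj (by omega) (by omega)).1).2 ⟨rfl, by simp⟩
  · congr 1; omega

/-- A theta graph together with a further chordless path of length `k` between its base points. -/
theorem IsTheta.extend {r : ℕ} {F : ℕ → ℕ → V} {P : ℕ → V} (hF : G.IsTheta k r F) (hk : 2 ≤ k)
    (hr : 0 < r) (hP : G.NoChord H k P) (harc : G.IsArc k P) (hFH : branchSet k r F ⊆ H)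
    (h0 : P 0 = F 0 0) (h1 : P k = F 0 k) :
    G.IsTheta k (r + 1) (fun i => if i < r then F i else P) := by
  have base : ∀ i < r, F i 0 = F 0 0 ∧ F i k = F 0 k := fun i hi =>
    ⟨(hF i 0 0 0 hi hr (by omega) (by omega)).1.2 (by simp),
      (hF i 0 k k hi hr le_rfl le_rfl).1.2 (by simp)⟩
  have key : ∀ i s t, i < r → 0 < s → s < k → 0 < t → t < k →
      P s ≠ F i t ∧ ¬ G.Adj (P s) (F i t) := by
    intro i s t hi hs hsk ht htk
    have hmem : F i t ∈ H := hFH ⟨i, t, hi, htk.le, rfl⟩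
    refine ⟨fun e => (hP s hs hsk).1 (e ▸ hmem), fun hadj => ?_⟩
    rcases (hP s hs hsk).2 _ hmem hadj with h2 | h2
    · have := ((hF i 0 t 0 hi hr htk.le (by omega)).1).1 (h2.2.trans h0); omega
    · have := ((hF i 0 t k hi hr htk.le (by omega)).1).1 (h2.2.trans h1); omega
  refine isTheta_of_isArc hk (fun i hi => ?_) (fun i hi => ?_) (fun i hi => ?_) ?_
  · split_ifs with h
    · exact hF.isArc h
    · exact harc
  · simp only [hr, if_true]
    split_ifs with h
    · exact (base i h).1
    · exact h0
  · simp only [hr, if_true]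
    split_ifs with h
    · exact (base i h).2
    · exact h1
  · intro i j s t hi hj hij hs hsk ht htk
    split_ifs with h h' h'
    · have := hF i j s t h h' hsk.le htk.le
      rw [Ne, this.1, this.2]
      omega
    · have := key i t s h ht htk hs hsk
      exact ⟨this.1.symm, fun e => this.2 e.symm⟩
    · exact key j s t h' hs hsk ht htk
    · omega

/-- A chordless cycle of length `2 * k` is a theta graph based at any two antipodal vertices. -/
theorem IsHoleSeq.isTheta {C : ℕ → V} (hC : G.IsHoleSeq (2 * k) C) (hk : 2 ≤ k) {x : ℕ}
    (hx : x < k) :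
    G.IsTheta k 2 (fun i => if i = 0 then fun t => C (x + t) else backward (2 * k) x C) := by
  have hA := hC.isArc_forward (x := x) (y := x + k) (by omega) (by omega) (by omega)
  have hB := hC.isArc_backward (x := x) (y := x + k) (by omega) (by omega)
  rw [show x + k - x = k by omega] at hA hB
  rw [show 2 * k - k = k by omega] at hB
  have key : ∀ s t, 0 < s → s < k → 0 < t → t < k →
      C (x + s) ≠ backward (2 * k) x C t ∧ ¬ G.Adj (C (x + s)) (backward (2 * k) x C t) :=
    fun s t hs hsk ht htk => by
      refine ⟨fun e => ?_, hC.forward_not_adj_backward (y := x + k) (by omega) (by omega)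
        hs (by omega) ht (by omega)⟩
      have := hC.forward_ne_backward (x := x) (y := x + k) (by omega) (by omega)
        (by omega) (by omega) e
      omega
  refine isTheta_of_isArc hk (fun i hi => ?_) (fun i hi => ?_) (fun i hi => ?_) ?_
  · split_ifs
    · exact hA
    · exact hB
  · rw [if_pos (rfl : 0 = 0)]
    split_ifs
    · rfl
    · simp [backward]
  · rw [if_pos (rfl : 0 = 0)]
    split_ifs
    · rfl
    · rw [backward, if_neg (by omega)]
      congr 1; omega
  · intro i j s t hi hj hij hs hsk ht htk
    split_ifs with h h' h'
    · omega
    · exact key s t hs hsk ht htk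
    · have := key t s ht htk hs hsk
      exact ⟨this.1.symm, fun e => this.2 e.symm⟩
    · omega

/-- The path from `F i s` through `F 0 0`, the branch `l` and `F 0 k` to `F j (k - s)`. -/
theorem IsTheta.isArc_detour {r : ℕ} {F : ℕ → ℕ → V} (hF : G.IsTheta k r F) {i j l s : ℕ}
    (hi : i < r) (hj : j < r) (hl : l < r) (hij : i ≠ j) (hil : i ≠ l) (hjl : j ≠ l)
    (hs : 0 < s) (hsk : s + 1 < k) :
    G.IsArc (2 * s + k) (fun x => if x < s then F i (s - x) else
      if x ≤ s + k then F l (x - s) else F j (2 * k + s - x)) := by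
  intro x y hx hy
  dsimp only
  split_ifs
  · have := hF i i (s - x) (s - y) hi hi (by omega) (by omega)
    rw [this.1, this.2]; omega
  · have := hF i l (s - x) (y - s) hi hl (by omega) (by omega)
    rw [this.1, this.2]; omega
  · have := hF i j (s - x) (2 * k + s - y) hi hj (by omega) (by omega)
    rw [this.1, this.2]; omega
  · have := hF l i (x - s) (s - y) hl hi (by omega) (by omega)
    rw [this.1, this.2]; omega
  · have := hF l l (x - s) (y - s) hl hl (by omega) (by omega)
    rw [this.1, this.2]; omega
  · have := hF l j (x - s) (2 * k + s - y) hl hj (by omega) (by omega)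
    rw [this.1, this.2]; omega
  · have := hF j i (2 * k + s - x) (s - y) hj hi (by omega) (by omega)
    rw [this.1, this.2]; omega
  · have := hF j l (2 * k + s - x) (y - s) hj hl (by omega) (by omega)
    rw [this.1, this.2]; omega
  · have := hF j j (2 * k + s - x) (2 * k + s - y) hj hj (by omega) (by omega)
    rw [this.1, this.2]; omega

theorem IsTheta.flip {r : ℕ} {F : ℕ → ℕ → V} (hF : G.IsTheta k r F) :
    G.IsTheta k r (fun i s => F i (k - s)) := by
  intro i j s t hi hj hs ht
  have := hF i j (k - s) (k - t) hi hj (by omega) (by omega)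
  rw [this.1, this.2]
  omega

/-- A chordless path of length `k` joins no two interior vertices of distinct branches at total
distance `k` from the first base point, if there is a third branch. -/
theorem IsTheta.not_interior {r : ℕ} {F : ℕ → ℕ → V} {P : ℕ → V} (hF : G.IsTheta k r F)
    (hno : G.NoChord (branchSet k r F) k P) (harc : G.IsArc k P) (hG : G.AllHoles k)
    {i j l s : ℕ} (hi : i < r) (hj : j < r) (hl : l < r) (hij : i ≠ j) (hil : i ≠ l)
    (hjl : j ≠ l) (hs : 0 < s) (hsk : s + 1 < k) (h0 : P 0 = F i s) (h1 : P k = F j (k - s)) :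
    False := by
  -- The detour has length `2 * s + k`, so with `P` it closes to a hole of length `2 * k + 2 * s`.
  have hQ := hF.isArc_detour (s := s) hi hj hl hij hil hjl (by omega) (by omega)
  have := hno.add_eq hG harc hQ (fun t ht => ?_) ?_ ?_ (by omega) (by omega)
  · omega
  · split_ifs
    · exact ⟨i, _, hi, by omega, rfl⟩
    · exact ⟨l, _, hl, by omega, rfl⟩
    · exact ⟨j, _, hj, by omega, rfl⟩
  · simpa [hs] using h0
  · rw [h1, if_neg (by omega), if_neg (by omega)]
    congr 1
    omega

/-- A shortest ear of an induced theta graph has length `k`, no chords, and joins vertices that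
are antipodal on every cycle `thetaCycle k F i j` through them. -/
theorem IsTheta.ear_antipodal {r m : ℕ} {F : ℕ → ℕ → V} {P : ℕ → V} (hF : G.IsTheta k r F)
    (hP : G.IsEar (branchSet k r F) m P)
    (hmin : ∀ m' P', G.IsEar (branchSet k r F) m' P' → m ≤ m')
    (hG : G.AllHoles k) (hk : 3 ≤ k) {i j x y : ℕ} (hi : i < r) (hj : j < r) (hij : i ≠ j)
    (hx : x < 2 * k) (hy : y < 2 * k) (h0 : P 0 = thetaCycle k F i j x)
    (h1 : P m = thetaCycle k F i j y) :
    m = k ∧ (y = x + k ∨ x = y + k) ∧ G.NoChord (branchSet k r F) m P := by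
  have hC := hF.isHoleSeq (by omega) hi hj hij
  have hCH := fun x (hx : x < 2 * k) => thetaCycle_mem (F := F) hi hj hx
  rcases lt_trichotomy x y with hxy | rfl | hxy
  · obtain ⟨h2, h3, h4⟩ := hP.antipodal hmin hG hk hC hCH hxy hy h0 h1
    exact ⟨h2, Or.inl h3, h4⟩
  · exact absurd (h0.trans h1.symm) hP.ne
  · obtain ⟨h2, h3, h4⟩ := hP.reverse.antipodal hmin hG hk hC hCH hxy hx (by simpa using h1)
      (by simpa using h0)
    refine ⟨h2, Or.inr h3, ?_⟩
    intro a ha ham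
    have := h4.reverse a ha ham
    simpa [show m - (m - a) = a by omega] using this

/-- Any two vertices of a theta lie on a common cycle of two branches, so the analysis of ears of a
single hole applies. Starting with the branch of `P 0` gives `x ≤ k`. -/
theorem IsTheta.exists_position {r m : ℕ} {F : ℕ → ℕ → V} {P : ℕ → V} (hF : G.IsTheta k r F)
    (hr : 2 ≤ r) (hP : G.IsEar (branchSet k r F) m P) (hk : 3 ≤ k) :
    ∃ i j x y, i < r ∧ j < r ∧ i ≠ j ∧ x ≤ k ∧ y < 2 * k ∧
      P 0 = thetaCycle k F i j x ∧ P m = thetaCycle k F i j y := by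
  obtain ⟨i, s, hi, hs, h0⟩ := hP.start_mem
  obtain ⟨j, t, hj, ht, h1⟩ := hP.end_mem
  rcases eq_or_ne i j with rfl | hij
  · obtain ⟨j, hj, hij⟩ : ∃ j < r, i ≠ j := by
      rcases Nat.eq_zero_or_pos i with rfl | h
      · exact ⟨1, by omega, by omega⟩
      · exact ⟨0, by omega, by omega⟩
    refine ⟨i, j, s, t, hi, hj, hij, hs, by omega, ?_, ?_⟩
    · rw [thetaCycle, if_pos hs, h0]
    · rw [thetaCycle, if_pos ht, h1]
  · refine ⟨i, j, s, secondIndex k t, hi, hj, hij, hs, ?_, ?_, ?_⟩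
    · unfold secondIndex; split_ifs <;> omega
    · rw [thetaCycle, if_pos hs, h0]
    · rw [hF.thetaCycle_secondIndex hi hj ht, h1]

/-- The shortest ear becomes a new branch; what needs proof is that its ends can be taken as base
points. -/
theorem IsTheta.exists_extension {r m : ℕ} {F : ℕ → ℕ → V} {P : ℕ → V} (hF : G.IsTheta k r F)
    (hr : 2 ≤ r) (hP : G.IsEar (branchSet k r F) m P)
    (hmin : ∀ m' P', G.IsEar (branchSet k r F) m' P' → m ≤ m')
    (hG : G.AllHoles k) (hk : 3 ≤ k) : ∃ F', G.IsTheta k (r + 1) F' := by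
  have harc := hP.isArc hmin
  obtain ⟨i, j, x, y, hi, hj, hij, hxk, hy, h0, h1⟩ := hF.exists_position hr hP hk
  obtain ⟨rfl, hxy, hno⟩ := hF.ear_antipodal hP hmin hG hk hi hj hij (by omega) hy h0 h1
  have hnoR := hno.reverse
  have harcR := harc.reverse
  have base : ∀ a b, a < r → b < r → F a 0 = F b 0 ∧ F a m = F b m := fun a b ha hb =>
    ⟨(hF a b 0 0 ha hb (by omega) (by omega)).1.2 (by simp),
      (hF a b m m ha hb le_rfl le_rfl).1.2 (by simp)⟩
  rcases Nat.eq_or_lt_of_le hr with rfl | hr3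
  -- With two branches the theta is just a hole and has no preferred base points: it is rebased at
  -- the ends of the ear, starting from the smaller index.
  · have hC := hF.isHoleSeq (by omega) hi hj hij
    have hsub : ∀ x < m, branchSet m 2 (fun a => if a = 0 then
        fun t => thetaCycle m F i j (x + t) else backward (2 * m) x (thetaCycle m F i j)) ⊆
        branchSet m 2 F := by
      rintro x hx _ ⟨a, t, ha, ht, rfl⟩
      dsimp only
      split_ifs
      · rcases eq_or_ne (x + t) (2 * m) with h | h
        · omega
        · exact thetaCycle_mem hi hj (by omega)
      · unfold backward
        split_ifs
        · exact thetaCycle_mem hi hj (by omega)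
        · exact thetaCycle_mem hi hj (by omega)
    rcases hxy with rfl | rfl
    · exact ⟨_, (hC.isTheta (by omega) (x := x) (by omega)).extend (by omega) (by omega) hno harc
        (hsub x (by omega)) (by simpa using h0) (by simpa using h1)⟩
    · exact ⟨_, (hC.isTheta (by omega) (x := y) (by omega)).extend (by omega) (by omega) hnoR harcR
        (hsub y (by omega)) (by simpa using h1) (by simpa using h0)⟩
  · have hx0 : x = 0 ∨ x = m := by
      by_contra hcon
      have hyx : y = x + m := by omega
      obtain ⟨l, hl, hil, hjl⟩ : ∃ l < r, i ≠ l ∧ j ≠ l := by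
        by_cases h2 : i ≠ 0 ∧ j ≠ 0
        · exact ⟨0, by omega, h2⟩
        by_cases h3 : i ≠ 1 ∧ j ≠ 1
        · exact ⟨1, by omega, h3⟩
        · exact ⟨2, by omega, by omega, by omega⟩
      have h0' : P 0 = F i x := by rw [h0, thetaCycle, if_pos hxk]
      have h1' : P m = F j (m - x) := by
        rw [h1, thetaCycle, if_neg (by omega)]
        congr 1; omega
      by_cases hxm : x + 1 < m
      · exact hF.not_interior hno harc hG hi hj hl hij hil hjl (by omega) hxm h0' h1'
      -- For `x = m - 1` the detour through `F 0 0` is not induced, since `F i x` is adjacent to `F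
      -- 0 m`. Exchanging the base points replaces `x` by 1.
      · have hset : branchSet m r (fun i s => F i (m - s)) ⊆ branchSet m r F := by
          rintro _ ⟨a, t, ha, ht, rfl⟩
          exact ⟨a, _, ha, by omega, rfl⟩
        refine hF.flip.not_interior (fun a ha ham => ?_) harc hG hi hj hl hij hil hjl
          (s := m - x) (by omega) (by omega) ?_ ?_
        · exact ⟨fun h => (hno a ha ham).1 (hset h), fun h hh => (hno a ha ham).2 h (hset hh)⟩
        · rw [h0']; congr 1; omega
        · rw [h1']; congr 1; omega
    have hy0 : y = x + m ∧ x = 0 ∨ x = m ∧ y = 0 := by omega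
    rcases hy0 with ⟨rfl, rfl⟩ | ⟨rfl, rfl⟩
    · refine ⟨_, hF.extend (by omega) (by omega) hno harc le_rfl ?_ ?_⟩
      · rw [h0, thetaCycle, if_pos (by omega)]
        exact (base _ _ hi (by omega)).1
      · rw [h1, thetaCycle, if_pos (by omega), zero_add]
        exact (base _ _ hi (by omega)).2
    · refine ⟨_, hF.extend (by omega) (by omega) hnoR harcR le_rfl ?_ ?_⟩
      · rw [Nat.sub_zero, h1, thetaCycle, if_pos (by omega)]
        exact (base _ _ hi (by omega)).1
      · rw [Nat.sub_self, h0, thetaCycle, if_pos (by omega)]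
        exact (base _ _ hi (by omega)).2

end

/-! ### Connectivity, existence of ears, and spanning thetas -/

section
variable {V : Type*} {G : SimpleGraph V} {k : ℕ} {H : Set V}

/-- Any two vertices other than `v` are joined by a walk avoiding `v`. -/
def Avoids {V : Type*} (G : SimpleGraph V) : Prop :=
  ∀ v x y : V, x ≠ v → y ≠ v → ∃ p : G.Walk x y, v ∉ p.support

/-- Any two vertices outside an edge `ab` are joined by a walk avoiding `a` and `b`. -/
def AvoidsEdges {V : Type*} (G : SimpleGraph V) : Prop :=
  ∀ a b x y : V, G.Adj a b → x ≠ a → x ≠ b → y ≠ a → y ≠ b →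
    ∃ p : G.Walk x y, a ∉ p.support ∧ b ∉ p.support

theorem avoids_iff : G.Avoids ↔ ∀ (v x y : V) (hx : x ≠ v) (hy : y ≠ v),
    (G.induce {z : V | z ≠ v}).Reachable ⟨x, hx⟩ ⟨y, hy⟩ := by
  refine ⟨fun h v x y hx hy => ?_, fun h v x y hx hy => ?_⟩
  · obtain ⟨p, hp⟩ := h v x y hx hy
    exact ⟨p.induce _ fun z hz => by rintro rfl; exact hp hz⟩
  · obtain ⟨p⟩ := h v x y hx hy
    let f : G.induce {z : V | z ≠ v} →g G := (Embedding.induce _).toHom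
    have hv : v ∉ (p.map f).support := by
      rw [Walk.support_map, List.mem_map]
      rintro ⟨z, -, hz⟩
      exact z.2 hz
    exact ⟨p.map f, hv⟩

theorem Connected.avoids (hG : G.Connected) (h : ∀ v, ¬ G.IsCutVertex v) : G.Avoids := by
  rw [avoids_iff]
  intro v x y hx hy
  by_contra hcon
  exact h v ⟨x, y, hx, hy, hG.preconnected x y, hcon⟩

theorem Avoids.not_isCutVertex (hG : G.Avoids) (v : V) : ¬ G.IsCutVertex v := by
  rintro ⟨x, y, hx, hy, -, h⟩
  exact h (avoids_iff.1 hG v x y hx hy)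

theorem AllHoles.of_embedding {W : Type*} {G' : SimpleGraph W} (hG : G.AllHoles k)
    (f : G' ↪g G) : G'.AllHoles k := fun n C hn hC =>
  hG n (f ∘ C) hn fun x y hx hy => by simpa using hC x y hx hy

theorem Walk.exists_isEar {a b z z' : V} (p : G.Walk z z') (hp : ∀ t ∈ p.support, t ∉ H)
    (ha : a ∈ H) (hb : b ∈ H) (haz : G.Adj z a) (hbz : G.Adj z' b) (hne : a ≠ b)
    (hadj : ¬ G.Adj a b) : ∃ m P, G.IsEar H m P := by
  refine ⟨p.length + 2, fun x => if x = 0 then a else if x ≤ p.length + 1 then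
    p.getVert (x - 1) else b, ?_, ?_, ?_, ?_, fun i h0 h1 => ?_, fun i hi => ?_⟩
  · simpa using ha
  · simpa using hb
  · simpa using hne
  · simpa using hadj
  · rw [if_neg (by omega), if_pos (by omega)]
    exact hp _ (p.getVert_mem_support _)
  · rcases Nat.eq_zero_or_pos i with rfl | h0
    · simpa using haz.symm
    · rw [if_neg (by omega), if_pos (by omega), if_neg (by omega)]
      split_ifs with h
      · rw [show i + 1 - 1 = i - 1 + 1 by omega]
        exact p.adj_getVert_succ (by omega)
      · rw [show i - 1 = p.length by omega, p.getVert_length]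
        exact hbz

/-- Without an ear, the attachments in `H` of the component of `w` outside `H` form a clique. With
no triangles they lie in one edge of `H`, which then separates `w` from a third vertex of `H`. -/
theorem AvoidsEdges.exists_isEar (hE : G.AvoidsEdges) (hG : G.AllHoles k) (hk : 3 ≤ k)
    (hadj : ∀ a ∈ H, ∃ b ∈ H, G.Adj a b) (hthree : ∀ a b : V, ∃ c ∈ H, c ≠ a ∧ c ≠ b)
    {w : V} (hw : w ∉ H) : ∃ m P, G.IsEar H m P := by
  by_contra hcon
  let K : Set V := {z | ∃ p : G.Walk w z, ∀ t ∈ p.support, t ∉ H}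
  let N : Set V := {a | a ∈ H ∧ ∃ z ∈ K, G.Adj z a}
  have hN : ∀ a ∈ N, ∀ b ∈ N, a ≠ b → G.Adj a b := by
    rintro a ⟨ha, z, ⟨p, hp⟩, hz⟩ b ⟨hb, z', ⟨q, hq⟩, hz'⟩ hne
    by_contra hab
    refine hcon ((p.reverse.append q).exists_isEar (fun t ht => ?_) ha hb hz hz' hne hab)
    rw [Walk.mem_support_append_iff, Walk.support_reverse, List.mem_reverse] at ht
    exact ht.elim (hp t) (hq t)
  obtain ⟨a, ha, b, hb, hab, hsub⟩ : ∃ a ∈ H, ∃ b ∈ H, G.Adj a b ∧ ∀ c ∈ N, c = a ∨ c = b := by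
    by_cases hne : ∃ a ∈ N, ∃ b ∈ N, a ≠ b
    · obtain ⟨a, ha, b, hb, hne⟩ := hne
      refine ⟨a, ha.1, b, hb.1, hN a ha b hb hne, fun c hc => ?_⟩
      by_contra hcab
      push Not at hcab
      exact hG.not_triangle hk (hN a ha b hb hne) (hN b hb c hc hcab.2.symm) (hN c hc a ha hcab.1)
    · push Not at hne
      obtain ⟨a, ha, haN⟩ : ∃ a ∈ H, ∀ c ∈ N, c = a := by
        by_cases h : N.Nonempty
        · obtain ⟨a, ha⟩ := h
          exact ⟨a, ha.1, fun c hc => hne c hc a ha⟩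
        · obtain ⟨c, hc, -⟩ := hthree w w
          exact ⟨c, hc, fun d hd => absurd ⟨d, hd⟩ h⟩
      obtain ⟨b, hb, hab⟩ := hadj a ha
      exact ⟨a, ha, b, hb, hab, fun c hc => Or.inl (haN c hc)⟩
  obtain ⟨c, hc, hca, hcb⟩ := hthree a b
  obtain ⟨p, hpa, hpb⟩ := hE a b w c hab (fun e => hw (e ▸ ha)) (fun e => hw (e ▸ hb)) hca hcb
  have hwK : w ∈ K := ⟨Walk.nil, by simpa using hw⟩
  have hcK : c ∉ K := fun ⟨q, hq⟩ => hq c q.end_mem_support hc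
  -- Where the walk leaves `K` it enters `H` at an attachment, hence at `a` or `b`, which it avoids.
  obtain ⟨d, hd, hd1, hd2⟩ := p.exists_boundary_dart K hwK hcK
  have hmem : d.snd ∈ H := by
    by_contra h
    obtain ⟨q, hq⟩ := hd1
    refine hd2 ⟨q.concat d.adj, fun t ht => ?_⟩
    rw [Walk.support_concat, List.mem_append, List.mem_singleton] at ht
    rcases ht with ht | rfl
    · exact hq t ht
    · exact h
  have hsupp := p.dart_snd_mem_support_of_mem_darts hd
  rcases hsub d.snd ⟨hmem, d.fst, hd1, d.adj⟩ with h | h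
  · exact hpa (h ▸ hsupp)
  · exact hpb (h ▸ hsupp)

theorem Walk.exists_adj_mem_support {x y : V} (p : G.Walk x y) (h : x ≠ y) :
    ∃ z ∈ p.support, G.Adj x z := by
  cases p with
  | nil => exact absurd rfl h
  | cons hadj q => exact ⟨_, by simp, hadj⟩

/-- A vertex `v` has two neighbours `a` and `b`; a path between them avoiding `v` closes up through
`v`. -/
theorem Avoids.exists_isCycleSeq (hG : G.Avoids) (h3 : ∃ a b c : V, a ≠ b ∧ a ≠ c ∧ b ≠ c) :
    ∃ n C, 3 ≤ n ∧ G.IsCycleSeq n C := by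
  classical
  obtain ⟨v, x, y, hvx, hvy, hxy⟩ := h3
  have hthird : ∀ a, ∃ c, c ≠ v ∧ c ≠ a := fun a => by
    by_cases h : x = a
    · exact ⟨y, hvy.symm, h ▸ hxy.symm⟩
    · exact ⟨x, hvx.symm, h⟩
  obtain ⟨p, -⟩ := hG y v x hvy hxy
  obtain ⟨a, -, ha⟩ := p.exists_adj_mem_support hvx
  obtain ⟨c, hcv, hca⟩ := hthird a
  obtain ⟨q, hq⟩ := hG a v c ha.ne hca
  obtain ⟨b, hbq, hb⟩ := q.exists_adj_mem_support hcv.symm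
  have hab : a ≠ b := fun e => hq (e ▸ hbq)
  obtain ⟨r, hr⟩ := hG v a b ha.ne' hb.ne'
  have hpath := r.bypass_isPath
  have hv : ∀ i, r.bypass.getVert i ≠ v := fun i e =>
    hr (r.support_bypass_subset_support (e ▸ r.bypass.getVert_mem_support i))
  have hlen : r.bypass.length ≠ 0 := fun h => hab (Walk.eq_of_length_eq_zero h)
  refine ⟨r.bypass.length + 2, fun x => if x ≤ r.bypass.length then r.bypass.getVert x else v,
    by omega, fun x y hx hy h => ?_, fun x hx => ?_, ?_⟩
  · split_ifs at h with h1 h2 h2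
    · exact hpath.getVert_injOn h1 h2 h
    · exact absurd h (hv x)
    · exact absurd h.symm (hv y)
    · omega
  · rw [if_pos (by omega)]
    split_ifs with h
    · exact Walk.adj_getVert_succ _ h
    · obtain rfl : x = r.bypass.length := by omega
      rw [Walk.getVert_length]
      exact hb.symm
  · simpa using ha

/-- A graph without separating edges in which all chordless cycles have length `2 * k` is spanned
by an induced theta graph. -/
theorem Avoids.exists_isTheta [Finite V] (hG : G.Avoids)
    (h3 : ∃ a b c : V, a ≠ b ∧ a ≠ c ∧ b ≠ c) (hE : G.AvoidsEdges) (hH : G.AllHoles k)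
    (hk : 3 ≤ k) : ∃ r F, 2 ≤ r ∧ G.IsTheta k r F ∧ branchSet k r F = Set.univ := by
  classical
  -- A largest `r` exists because the vertices `F i 1` are distinct, which bounds `r` by the number
  -- of vertices.
  obtain ⟨r, hr, ⟨F, hF⟩, hmax⟩ : ∃ r, 2 ≤ r ∧ (∃ F, G.IsTheta k r F) ∧
      ¬ ∃ F, G.IsTheta k (r + 1) F := by
    by_contra hcon
    push Not at hcon
    have hall : ∀ n, ∃ F, G.IsTheta k (n + 2) F := by
      intro n
      induction n with
      | zero =>
        obtain ⟨n, C, hn, hC⟩ := hG.exists_isCycleSeq h3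
        obtain ⟨m, D, hm, -, hD⟩ := hC.exists_isHoleSeq hn
        obtain rfl := hH m D hm hD
        exact ⟨_, hD.isTheta (by omega) (x := 0) (by omega)⟩
      | succ n ih =>
        obtain ⟨F, hF⟩ := ih
        obtain ⟨F', hF'⟩ := hcon (n + 2) (by omega) ⟨F, hF⟩
        exact ⟨F', hF'⟩
    obtain ⟨F, hF⟩ := hall (Nat.card V)
    have hinj : Function.Injective (fun i : Fin (Nat.card V + 2) => F i 1) := fun i j h => by
      have := ((hF i j 1 1 i.2 j.2 (by omega) (by omega)).1).1 h
      exact Fin.ext (by omega)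
    have := Nat.card_le_card_of_injective _ hinj
    simp at this
  refine ⟨r, F, hr, hF, ?_⟩
  by_contra hne
  obtain ⟨w, hw⟩ := (Set.ne_univ_iff_exists_notMem _).1 hne
  have hear : ∃ m P, G.IsEar (branchSet k r F) m P := by
    refine hE.exists_isEar hH hk ?_ (fun a b => ?_) hw
    · rintro _ ⟨i, s, hi, hs, rfl⟩
      rcases Nat.lt_or_ge s k with h | h
      · exact ⟨F i (s + 1), ⟨i, s + 1, hi, h, rfl⟩, (hF i i _ _ hi hi hs h).2.2 (by simp)⟩
      · exact ⟨F i (s - 1), ⟨i, s - 1, hi, by omega, rfl⟩,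
          (hF i i _ _ hi hi hs (by omega)).2.2 ⟨by omega, by simp⟩⟩
    · by_contra hc
      push Not at hc
      have hmem : ∀ s ≤ k, F 0 s ∈ branchSet k r F := fun s hs => ⟨0, s, by omega, hs, rfl⟩
      have hinj : ∀ s t, s ≤ k → t ≤ k → F 0 s = F 0 t → s = t := fun s t hs ht h =>
        (hF.isArc (by omega) s t hs ht).1 h
      have h01 := hinj 0 1 (by omega) (by omega)
      have h02 := hinj 0 2 (by omega) (by omega)
      have h12 := hinj 1 2 (by omega) (by omega)
      have c0 := hc _ (hmem 0 (by omega))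
      have c1 := hc _ (hmem 1 (by omega))
      have c2 := hc _ (hmem 2 (by omega))
      have key : ∀ p q r : V, p ≠ q → p ≠ r → q ≠ r → (p ≠ a → p = b) → (q ≠ a → q = b) →
          (r ≠ a → r = b) → False := by
        intro p q r hpq hpr hqr hp hq hr
        by_cases h1 : p = a
        · exact hqr ((hq (h1 ▸ hpq.symm)).trans (hr (h1 ▸ hpr.symm)).symm)
        by_cases h2 : q = a
        · exact hpr ((hp h1).trans (hr (h2 ▸ hqr.symm)).symm)
        · exact hpq ((hp h1).trans (hq h2).symm)
      exact key _ _ _ (by simpa using h01) (by simpa using h02) (by simpa using h12) c0 c1 c2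
  obtain ⟨P, hP⟩ := Nat.find_spec hear
  exact hmax (hF.exists_extension hr hP (fun m' P' h => Nat.find_min' hear ⟨P', h⟩) hH hk)

end

/-! ### Coordinates on the theta graph -/

section Theta
variable {r k : ℕ}

@[simp] theorem thetaGraph_adj_first_inner {i : Fin r} {j : Fin (k - 1)} :
    (thetaGraph r k).Adj .first (.inner i j) ↔ (j : ℕ) = 0 := by
  rw [thetaGraph, fromRel_adj]
  refine ⟨?_, fun h => ⟨by simp, Or.inl (.start i j h)⟩⟩
  rintro ⟨-, h | h⟩ <;> cases h
  assumption

@[simp] theorem thetaGraph_adj_inner_last {i : Fin r} {j : Fin (k - 1)} :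
    (thetaGraph r k).Adj (.inner i j) .last ↔ (j : ℕ) + 1 = k - 1 := by
  rw [thetaGraph, fromRel_adj]
  refine ⟨?_, fun h => ⟨by simp, Or.inl (.finish i j h)⟩⟩
  rintro ⟨-, h | h⟩ <;> cases h
  assumption

@[simp] theorem thetaGraph_adj_inner_first {i : Fin r} {j : Fin (k - 1)} :
    (thetaGraph r k).Adj (.inner i j) .first ↔ (j : ℕ) = 0 := by
  rw [adj_comm, thetaGraph_adj_first_inner]

@[simp] theorem thetaGraph_adj_last_inner {i : Fin r} {j : Fin (k - 1)} :
    (thetaGraph r k).Adj .last (.inner i j) ↔ (j : ℕ) + 1 = k - 1 := by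
  rw [adj_comm, thetaGraph_adj_inner_last]

@[simp] theorem thetaGraph_not_adj_first_last : ¬ (thetaGraph r k).Adj .first .last := by
  rw [thetaGraph, fromRel_adj]
  rintro ⟨-, h | h⟩ <;> cases h

@[simp] theorem thetaGraph_not_adj_last_first : ¬ (thetaGraph r k).Adj .last .first := by
  rw [adj_comm]
  exact thetaGraph_not_adj_first_last

@[simp] theorem thetaGraph_adj_inner_inner {i i' : Fin r} {j j' : Fin (k - 1)} :
    (thetaGraph r k).Adj (.inner i j) (.inner i' j') ↔
      i = i' ∧ ((j : ℕ) + 1 = j' ∨ (j' : ℕ) + 1 = j) := by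
  rw [thetaGraph, fromRel_adj]
  constructor
  · rintro ⟨-, h | h⟩ <;> cases h
    · exact ⟨rfl, by omega⟩
    · exact ⟨rfl, by omega⟩
  · rintro ⟨rfl, h | h⟩
    · exact ⟨by simp [Fin.ext_iff]; omega, Or.inl (.step i j j' h.symm)⟩
    · exact ⟨by simp [Fin.ext_iff]; omega, Or.inr (.step i j' j h.symm)⟩

/-- The `s`-th vertex of the `i`-th branch of the theta graph. -/
def thetaCoord (r k i s : ℕ) : ThetaVertex r k :=
  if s = 0 then .first
  else if h : i < r ∧ s - 1 < k - 1 then .inner ⟨i, h.1⟩ ⟨s - 1, h.2⟩ else .last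

theorem isTheta_thetaCoord (hk : 2 ≤ k) : (thetaGraph r k).IsTheta k r (thetaCoord r k) := by
  intro i j s t hi hj hs ht
  unfold thetaCoord
  split_ifs <;> simp <;> omega

theorem exists_thetaCoord_eq (hr : 0 < r) (hk : 2 ≤ k) (z : ThetaVertex r k) :
    ∃ i s, i < r ∧ s ≤ k ∧ thetaCoord r k i s = z := by
  cases z with
  | first => exact ⟨0, 0, hr, by omega, by simp [thetaCoord]⟩
  | last => exact ⟨0, k, hr, le_rfl, by simp [thetaCoord]; omega⟩
  | inner i j => exact ⟨i, j + 1, i.2, by omega, by simp [thetaCoord]⟩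

/-- `F` and `thetaCoord` obey the same rules for equality and adjacency, so matching coordinates is
an isomorphism, whichever coordinates are chosen for the base points. -/
theorem IsTheta.nonempty_iso {V : Type*} {G : SimpleGraph V} {F : ℕ → ℕ → V}
    (hF : G.IsTheta k r F) (hk : 2 ≤ k) (hr : 0 < r) (hu : branchSet k r F = Set.univ) :
    Nonempty (G ≃g thetaGraph r k) := by
  choose i s hi hs hz using exists_thetaCoord_eq (k := k) hr hk
  let f : ThetaVertex r k → V := fun z => F (i z) (s z)
  have hθ := isTheta_thetaCoord (r := r) hk
  have hf : ∀ a b, a < r → b ≤ k → f (thetaCoord r k a b) = F a b := fun a b ha hb =>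
    (hF _ _ _ _ (hi _) ha (hs _) hb).1.2 ((hθ _ _ _ _ (hi _) ha (hs _) hb).1.1 (hz _))
  have hinj : Function.Injective f := fun z w h => by
    rw [← hz z, ← hz w]
    exact (hθ _ _ _ _ (hi z) (hi w) (hs z) (hs w)).1.2
      ((hF _ _ _ _ (hi z) (hi w) (hs z) (hs w)).1.1 h)
  have hsurj : Function.Surjective f := fun v => by
    obtain ⟨a, b, ha, hb, rfl⟩ : v ∈ branchSet k r F := hu ▸ Set.mem_univ v
    exact ⟨_, hf a b ha hb⟩
  refine ⟨RelIso.symm ⟨Equiv.ofBijective f ⟨hinj, hsurj⟩, fun {z w} => ?_⟩⟩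
  have h1 := (hF _ _ _ _ (hi z) (hi w) (hs z) (hs w)).2
  have h2 := (hθ _ _ _ _ (hi z) (hi w) (hs z) (hs w)).2
  rw [hz, hz] at h2
  exact h1.trans h2.symm

end Theta

-- Decomposition along a separating edge

universe u

section
variable {V : Type*} {G : SimpleGraph V} {k : ℕ}

/-- Contracting everything outside `W` to `e` turns walks of `G` avoiding `v` into walks of
`G.induce W` avoiding `v`, if `W` is separated from its complement by the edge `ef`. -/
theorem Walk.exists_induce_walk {W : Set V} {e f : V} (he : e ∈ W) (hef : G.Adj e f)
    (hW : ∀ z ∈ W, ∀ z' ∉ W, G.Adj z z' → z = e ∨ z = f) {v : W} (hv : v ≠ ⟨e, he⟩)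
    (ρ : V → W) (hρ : ∀ z (hz : z ∈ W), ρ z = ⟨z, hz⟩) (hρ' : ∀ z ∉ W, ρ z = ⟨e, he⟩)
    {x y : V} (p : G.Walk x y) (hp : ↑v ∉ p.support) :
    ∃ q : (G.induce W).Walk (ρ x) (ρ y), v ∉ q.support := by
  induction p with
  | @nil u =>
    refine ⟨Walk.nil, fun h => hp ?_⟩
    rw [Walk.support_nil, List.mem_singleton] at h
    by_cases hu : u ∈ W
    · rw [h, hρ u hu]; simp
    · rw [hρ' u hu] at h
      exact absurd h hv
  | @cons u w y hadj p ih =>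
    rw [Walk.support_cons, List.mem_cons, not_or] at hp
    obtain ⟨q, hq⟩ := ih hp.2
    have hvu : v ≠ ρ u := by
      rintro rfl
      by_cases hu : u ∈ W
      · exact hp.1 (by rw [hρ u hu])
      · exact hv (hρ' u hu)
    -- An edge leaving `W` starts at `e` or `f`, so contraction turns it into a repetition of `e` or
    -- into the edge `ef`.
    have hstep : ρ u = ρ w ∨ (G.induce W).Adj (ρ u) (ρ w) := by
      by_cases hu : u ∈ W
      · by_cases hw : w ∈ W
        · right
          rw [hρ u hu, hρ w hw]
          exact hadj
        · rw [hρ u hu, hρ' w hw]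
          rcases hW u hu w hw hadj with rfl | rfl
          · exact Or.inl rfl
          · exact Or.inr hef.symm
      · by_cases hw : w ∈ W
        · rw [hρ' u hu, hρ w hw]
          rcases hW w hw u hu hadj.symm with rfl | rfl
          · exact Or.inl rfl
          · exact Or.inr hef
        · exact Or.inl ((hρ' u hu).trans (hρ' w hw).symm)
    rcases hstep with h | h
    · rw [h]
      exact ⟨q, hq⟩
    · exact ⟨Walk.cons h q, by simpa using ⟨hvu, hq⟩⟩

/-- The outside of `W` is contracted to whichever of `a`, `b` differs from the vertex to be avoided.
-/
theorem Avoids.induce (hG : G.Avoids) {W : Set V} {a b : V} (ha : a ∈ W) (hb : b ∈ W)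
    (hab : G.Adj a b) (hW : ∀ z ∈ W, ∀ z' ∉ W, G.Adj z z' → z = a ∨ z = b) :
    (G.induce W).Avoids := by
  classical
  have key : ∀ (e f : V) (he : e ∈ W), G.Adj e f →
      (∀ z ∈ W, ∀ z' ∉ W, G.Adj z z' → z = e ∨ z = f) → ∀ v x y : W, v ≠ ⟨e, he⟩ →
      x ≠ v → y ≠ v → ∃ p : (G.induce W).Walk x y, v ∉ p.support := by
    intro e f he hef hW v x y hv hx hy
    obtain ⟨p, hp⟩ := hG v x y (fun h => hx (Subtype.ext h)) (fun h => hy (Subtype.ext h))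
    let ρ : V → W := fun z => if hz : z ∈ W then ⟨z, hz⟩ else ⟨e, he⟩
    have hρ : ∀ z (hz : z ∈ W), ρ z = ⟨z, hz⟩ := fun z hz => dif_pos hz
    have := p.exists_induce_walk he hef hW hv ρ hρ (fun z hz => dif_neg hz) hp
    rwa [hρ x x.2, hρ y y.2] at this
  intro v x y hx hy
  by_cases hv : v = ⟨a, ha⟩
  · refine key b a hb hab.symm (fun z hz z' hz' h => (hW z hz z' hz' h).symm) v x y ?_ hx hy
    rw [hv]
    exact fun h => hab.ne (congrArg Subtype.val h)
  · exact key a b ha hab hW v x y hv hx hy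

theorem isTwoCliqueSum_induce {W₁ W₂ : Set V} {a b : V} (hab : G.Adj a b)
    (hinter : ∀ z, z ∈ W₁ ∧ z ∈ W₂ ↔ z = a ∨ z = b) (hunion : ∀ z, z ∈ W₁ ∨ z ∈ W₂)
    (hadj : ∀ z z', G.Adj z z' → (z ∈ W₁ ∧ z' ∈ W₁) ∨ (z ∈ W₂ ∧ z' ∈ W₂)) :
    IsTwoCliqueSum (G.induce W₁) (G.induce W₂) G := by
  have ha := (hinter a).2 (Or.inl rfl)
  have hb := (hinter b).2 (Or.inr rfl)
  refine ⟨⟨a, ha.1⟩, ⟨b, hb.1⟩, ⟨a, ha.2⟩, ⟨b, hb.2⟩, Sum.elim Subtype.val Subtype.val, hab, hab,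
    fun z => ?_, fun x y => by simp [Subtype.ext_iff], fun x y => by simp [Subtype.ext_iff],
    fun x y => ?_, fun s t => ?_⟩
  · rcases hunion z with h | h
    · exact ⟨.inl ⟨z, h⟩, rfl⟩
    · exact ⟨.inr ⟨z, h⟩, rfl⟩
  · simp only [Sum.elim_inl, Sum.elim_inr, Subtype.ext_iff]
    constructor
    · intro h
      rcases (hinter x).1 ⟨x.2, h ▸ y.2⟩ with h' | h'
      · exact Or.inl ⟨h', h ▸ h'⟩
      · exact Or.inr ⟨h', h ▸ h'⟩
    · rintro (h | h)
      · exact h.1.trans h.2.symm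
      · exact h.1.trans h.2.symm
  · constructor
    · intro h
      rcases hadj s t h with h' | h'
      · exact ⟨.inl ⟨s, h'.1⟩, .inl ⟨t, h'.2⟩, by simpa using h, rfl, rfl⟩
      · exact ⟨.inr ⟨s, h'.1⟩, .inr ⟨t, h'.2⟩, by simpa using h, rfl, rfl⟩
    · rintro ⟨x | x, y | y, h, rfl, rfl⟩
      · simpa using h
      · simp at h
      · simp at h
      · simpa using h

end

/-- A graph on at least three vertices without cut vertices all of whose chordless cycles have
length `2 * k` is a 2-clique sum of theta graphs. -/
theorem Avoids.isThetaCliqueSum {V : Type u} [Finite V] {G : SimpleGraph V} {k : ℕ}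
    (hk : 3 ≤ k) (hG : G.Avoids) (h3 : ∃ a b c : V, a ≠ b ∧ a ≠ c ∧ b ≠ c)
    (hH : G.AllHoles k) : IsThetaCliqueSum k G := by
  induction hn : Nat.card V using Nat.strong_induction_on generalizing V with
  | _ n ih =>
  subst hn
  by_cases hE : G.AvoidsEdges
  · obtain ⟨r, F, hr, hF, hu⟩ := hG.exists_isTheta h3 hE hH hk
    exact .theta G r hr (hF.nonempty_iso (by omega) (by omega) hu)
  · unfold AvoidsEdges at hE
    push Not at hE
    obtain ⟨a, b, x, y, hab, hxa, hxb, hya, hyb, hno⟩ := hE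
    -- `X` is the component of `x` after deleting `a` and `b`. The two sides are `X ∪ {a, b}`, which
    -- misses `y`, and `Xᶜ`, which misses `x`, so both are smaller.
    let X : Set V := {z | ∃ p : G.Walk x z, a ∉ p.support ∧ b ∉ p.support}
    have hxX : x ∈ X := ⟨Walk.nil, by simpa using hxa.symm, by simpa using hxb.symm⟩
    have hyX : y ∉ X := fun ⟨p, hp⟩ => hp.2 (hno p hp.1)
    have haX : a ∉ X := fun ⟨p, hp⟩ => hp.1 p.end_mem_support
    have hbX : b ∉ X := fun ⟨p, hp⟩ => hp.2 p.end_mem_support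
    have hstep : ∀ z ∈ X, ∀ z', G.Adj z z' → z' ∈ X ∨ z' = a ∨ z' = b := by
      rintro z ⟨p, hpa, hpb⟩ z' h
      by_contra hcon
      push Not at hcon
      refine hcon.1 ⟨p.concat h, ?_, ?_⟩
      · simpa [Walk.support_concat, hpa] using hcon.2.1.symm
      · simpa [Walk.support_concat, hpb] using hcon.2.2.symm
    let W₁ : Set V := X ∪ {a, b}
    have hW₁ : ∀ z, z ∈ W₁ ↔ z ∈ X ∨ z = a ∨ z = b := fun z => by
      simp [W₁, or_comm, or_assoc]
    have hW₂ : ∀ z, z ∈ Xᶜ ↔ z ∉ X := fun z => Iff.rfl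
    have ha₁ : a ∈ W₁ := by simp [W₁]
    have hb₁ : b ∈ W₁ := by simp [W₁]
    have hx₁ : x ∈ W₁ := Or.inl hxX
    have hy₁ : y ∉ W₁ := by simp [hW₁, hyX, hya, hyb]
    have hcard : ∀ (W : Set V) (z : V), z ∉ W → Nat.card W < Nat.card V := fun W z hz =>
      Finite.card_subtype_lt hz
    have hsum : ∀ W : Set V, Nat.card W < Nat.card V → a ∈ W → b ∈ W →
        (∃ c ∈ W, c ≠ a ∧ c ≠ b) → (∀ z ∈ W, ∀ z' ∉ W, G.Adj z z' → z = a ∨ z = b) →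
        IsThetaCliqueSum k (G.induce W) := by
      rintro W hlt ha hb ⟨c, hc, hca, hcb⟩ hW
      refine ih _ hlt (hG.induce ha hb hab hW) ⟨⟨a, ha⟩, ⟨b, hb⟩, ⟨c, hc⟩, ?_, ?_, ?_⟩
        (hH.of_embedding (Embedding.induce W)) rfl
      · simpa using hab.ne
      · simpa using hca.symm
      · simpa using hcb.symm
    refine .sum _ _ G (hsum W₁ (hcard _ y hy₁) ha₁ hb₁ ⟨x, hx₁, hxa, hxb⟩ ?_)
      (hsum Xᶜ (hcard _ x (by simpa using hxX)) haX hbX ⟨y, hyX, hya, hyb⟩ ?_)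
      (isTwoCliqueSum_induce hab ?_ ?_ ?_)
    · intro z hz z' hz' h
      rw [hW₁] at hz hz'
      rcases hz with hz | hz
      · exact absurd (hstep z hz z' h) hz'
      · exact hz
    · intro z hz z' hz' h
      rw [hW₂, not_not] at hz'
      exact (hstep z' hz' z h.symm).resolve_left hz
    · intro z
      rw [hW₁, hW₂]
      constructor
      · rintro ⟨h | h, h'⟩
        · exact absurd h h'
        · exact h
      · rintro (rfl | rfl)
        · exact ⟨Or.inr (Or.inl rfl), haX⟩
        · exact ⟨Or.inr (Or.inr rfl), hbX⟩
    · intro z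
      rw [hW₁, hW₂]
      tauto
    · intro z z' h
      have h2 := fun hz => hstep z' hz z h.symm
      have h1 := fun hz => hstep z hz z' h
      rw [hW₁, hW₁, hW₂, hW₂]
      tauto

/-! ### Holes in 2-clique sums -/

section
variable {V : Type*} {G : SimpleGraph V} {k : ℕ}

theorem exists_mem_separator {L R : Set V} {a b : V}
    (hinter : ∀ z, z ∈ L ∧ z ∈ R → z = a ∨ z = b)
    (hadj : ∀ z z', G.Adj z z' → (z ∈ L ∧ z' ∈ L) ∨ (z ∈ R ∧ z' ∈ R)) {l : ℕ} {A : ℕ → V}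
    (hA : ∀ i < l, G.Adj (A i) (A (i + 1))) (h0 : A 0 ∉ L) (hl : A l ∉ R) (hl0 : A 0 ∈ R) :
    ∃ s, 0 < s ∧ s < l ∧ (A s = a ∨ A s = b) := by
  by_contra hcon
  push Not at hcon
  have key : ∀ t, t ≤ l → A t ∉ L ∧ A t ∈ R := by
    intro t
    induction t with
    | zero => exact fun _ => ⟨h0, hl0⟩
    | succ t ih =>
      intro ht
      obtain ⟨h1, h2⟩ := ih (by omega)
      have h3 : A (t + 1) ∈ R := by
        rcases hadj _ _ (hA t ht) with h | h
        · exact absurd h.1 h1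
        · exact h.2
      refine ⟨fun h4 => ?_, h3⟩
      have h5 := hinter _ ⟨h4, h3⟩
      rcases eq_or_lt_of_le ht with h | h
      · exact hl (h ▸ h3)
      · have := hcon (t + 1) (by omega) h
        tauto
  exact hl (key l le_rfl).2

/-- If the hole leaves both sides, each of its two arcs between the witnesses has an interior vertex
in the separator. These vertices are distinct, hence are `a` and `b`, and the edge joining them is a
chord. -/
theorem IsHoleSeq.subset_side {L R : Set V} {a b : V} (hab : G.Adj a b)
    (hinter : ∀ z, z ∈ L ∧ z ∈ R → z = a ∨ z = b) (hunion : ∀ z, z ∈ L ∨ z ∈ R)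
    (hadj : ∀ z z', G.Adj z z' → (z ∈ L ∧ z' ∈ L) ∨ (z ∈ R ∧ z' ∈ R)) {n : ℕ} {C : ℕ → V}
    (hC : G.IsHoleSeq n C) : (∀ x < n, C x ∈ L) ∨ (∀ x < n, C x ∈ R) := by
  have key : ∀ (L R : Set V), (∀ z, z ∈ L ∧ z ∈ R → z = a ∨ z = b) → (∀ z, z ∈ L ∨ z ∈ R) →
      (∀ z z', G.Adj z z' → (z ∈ L ∧ z' ∈ L) ∨ (z ∈ R ∧ z' ∈ R)) → ∀ x y, x < y → y < n →
      C x ∉ L → C y ∉ R → False := by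
    intro L R hinter hunion hadj x y hxy hy hx hyR
    have hxR := (hunion (C x)).resolve_left hx
    have hna : ¬ G.Adj (C x) (C y) := fun h => by
      rcases hadj _ _ h with h | h
      · exact hx h.1
      · exact hyR h.2
    rw [(hC x y (by omega) hy).2] at hna
    have hA := hC.isArc_forward hxy hy (by omega)
    have hB := hC.isArc_backward (x := x) (y := y) (by omega) hy
    obtain ⟨s, hs0, hs, hs'⟩ := exists_mem_separator hinter hadj (A := fun t => C (x + t))
      (l := y - x) (fun i hi => (hA i (i + 1) hi.le hi).2.2 (Or.inl rfl)) (by simpa using hx)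
      (by simpa [show x + (y - x) = y by omega] using hyR) (by simpa using hxR)
    obtain ⟨t, ht0, ht, ht'⟩ := exists_mem_separator hinter hadj (A := backward n x C)
      (l := n - (y - x)) (fun i hi => (hB i (i + 1) hi.le hi).2.2 (Or.inl rfl))
      (by simpa [backward] using hx)
      (by
        rw [backward, if_neg (by omega), show n + x - (n - (y - x)) = y by omega]
        exact hyR)
      (by simpa [backward] using hxR)
    have h1 := hC.forward_not_adj_backward hxy hy hs0 hs ht0 ht
    have h2 : C (x + s) ≠ backward n x C t := fun h => by
      have := hC.forward_ne_backward hxy hy hs.le ht.le h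
      omega
    rcases hs' with hs' | hs' <;> rcases ht' with ht' | ht' <;> rw [hs', ht'] at h1 h2
    · exact h2 rfl
    · exact h1 hab
    · exact h1 hab.symm
    · exact h2 rfl
  by_contra hcon
  push Not at hcon
  obtain ⟨⟨x, hx, hxL⟩, ⟨y, hy, hyR⟩⟩ := hcon
  rcases lt_trichotomy x y with h | rfl | h
  · exact key L R hinter hunion hadj x y h hy hxL hyR
  · exact (hunion (C x)).elim hxL hyR
  · exact key R L (fun z hz => hinter z hz.symm) (fun z => (hunion z).symm)
      (fun z z' hz => (hadj z z' hz).symm) y x h hx hyR hxL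

theorem AllHoles.of_subset_range {W : Type*} {G' : SimpleGraph W} (hG : G'.AllHoles k) {f : W → V}
    (hf : ∀ x y, f x = f y ↔ x = y) (hadj : ∀ x y, G.Adj (f x) (f y) ↔ G'.Adj x y) {n : ℕ}
    {C : ℕ → V} (hn : 3 ≤ n) (hC : G.IsHoleSeq n C) (h : ∀ x < n, ∃ w, f w = C x) :
    n = 2 * k := by
  obtain ⟨w, -⟩ := h 0 (by omega)
  have h' : ∀ x, ∃ w, x < n → f w = C x := fun x => by
    by_cases hx : x < n
    · obtain ⟨w, hw⟩ := h x hx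
      exact ⟨w, fun _ => hw⟩
    · exact ⟨w, fun h => absurd h hx⟩
  choose D hD using h'
  refine hG n D hn fun x y hx hy => ?_
  rw [← hf, ← hadj, hD x hx, hD y hy]
  exact hC x y hx hy

end

section
variable {V₁ V₂ V : Type*} {G₁ : SimpleGraph V₁} {G₂ : SimpleGraph V₂} {G : SimpleGraph V} {k : ℕ}

theorem IsTwoCliqueSum.allHoles (h : IsTwoCliqueSum G₁ G₂ G) (h₁ : G₁.AllHoles k)
    (h₂ : G₂.AllHoles k) : G.AllHoles k := by
  obtain ⟨a₁, b₁, a₂, b₂, π, hab₁, hab₂, hsurj, hinj₁, hinj₂, hglue, hadj⟩ := h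
  have ha : π (.inl a₁) = π (.inr a₂) := (hglue _ _).2 (Or.inl ⟨rfl, rfl⟩)
  have hb : π (.inl b₁) = π (.inr b₂) := (hglue _ _).2 (Or.inr ⟨rfl, rfl⟩)
  have hadj₁ : ∀ x y, G.Adj (π (.inl x)) (π (.inl y)) ↔ G₁.Adj x y := by
    intro x y
    rw [hadj]
    refine ⟨?_, fun h => ⟨.inl x, .inl y, by simpa using h, rfl, rfl⟩⟩
    rintro ⟨x' | x', y' | y', h, hx, hy⟩
    · rw [← (hinj₁ _ _).1 hx, ← (hinj₁ _ _).1 hy]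
      simpa using h
    · simp at h
    · simp at h
    -- An edge of the other summand between shared vertices is the glued edge, which is an edge of
    -- `G₁` as well; so the summand is induced.
    · have h : G₂.Adj x' y' := by simpa using h
      rcases (hglue _ _).1 hx.symm with ⟨rfl, rfl⟩ | ⟨rfl, rfl⟩ <;>
        rcases (hglue _ _).1 hy.symm with ⟨rfl, rfl⟩ | ⟨rfl, rfl⟩
      · exact absurd rfl h.ne
      · exact hab₁
      · exact hab₁.symm
      · exact absurd rfl h.ne
  have hadj₂ : ∀ x y, G.Adj (π (.inr x)) (π (.inr y)) ↔ G₂.Adj x y := by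
    intro x y
    rw [hadj]
    refine ⟨?_, fun h => ⟨.inr x, .inr y, by simpa using h, rfl, rfl⟩⟩
    rintro ⟨x' | x', y' | y', h, hx, hy⟩
    · have h : G₁.Adj x' y' := by simpa using h
      rcases (hglue _ _).1 hx with ⟨rfl, rfl⟩ | ⟨rfl, rfl⟩ <;>
        rcases (hglue _ _).1 hy with ⟨rfl, rfl⟩ | ⟨rfl, rfl⟩
      · exact absurd rfl h.ne
      · exact hab₂
      · exact hab₂.symm
      · exact absurd rfl h.ne
    · simp at h
    · simp at h
    · rw [← (hinj₂ _ _).1 hx, ← (hinj₂ _ _).1 hy]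
      simpa using h
  intro n C hn hC
  have hside := hC.subset_side (L := Set.range fun x => π (.inl x))
    (R := Set.range fun y => π (.inr y)) ((hadj₁ a₁ b₁).2 hab₁) ?_ ?_ ?_
  · rcases hside with h | h
    · exact h₁.of_subset_range hinj₁ hadj₁ hn hC h
    · exact h₂.of_subset_range hinj₂ hadj₂ hn hC h
  · rintro z ⟨⟨x, rfl⟩, ⟨y, hy⟩⟩
    rcases (hglue _ _).1 hy.symm with ⟨rfl, -⟩ | ⟨rfl, -⟩
    · exact Or.inl rfl
    · exact Or.inr rfl
  · intro z
    obtain ⟨x | y, rfl⟩ := hsurj z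
    · exact Or.inl ⟨x, rfl⟩
    · exact Or.inr ⟨y, rfl⟩
  · intro z z' hzz
    obtain ⟨x | x, y | y, h, rfl, rfl⟩ := (hadj z z').1 hzz
    · exact Or.inl ⟨⟨x, rfl⟩, ⟨y, rfl⟩⟩
    · simp at h
    · simp at h
    · exact Or.inr ⟨⟨x, rfl⟩, ⟨y, rfl⟩⟩

end

/-! ### Holes in theta graphs -/

section
variable {V : Type*} {G : SimpleGraph V} {k : ℕ}

theorem IsHoleSeq.exists_neighbors {n : ℕ} {C : ℕ → V} (hC : G.IsHoleSeq n C) (hn : 3 ≤ n)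
    {x : ℕ} (hx : x < n) : ∃ y z, y < n ∧ z < n ∧ C y ≠ C z ∧ G.Adj (C x) (C y) ∧
      G.Adj (C x) (C z) ∧ ∀ w < n, G.Adj (C x) (C w) → C w = C y ∨ C w = C z := by
  have hy : (if x = 0 then n - 1 else x - 1) < n := by split_ifs <;> omega
  have hz : (if x + 1 = n then 0 else x + 1) < n := by split_ifs <;> omega
  refine ⟨_, _, hy, hz, fun h => ?_, (hC _ _ hx hy).2.2 ?_, (hC _ _ hx hz).2.2 ?_,
    fun w hw h => ?_⟩
  · have := (hC _ _ hy hz).1 h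
    split_ifs at this <;> omega
  · split_ifs <;> omega
  · split_ifs <;> omega
  · have := (hC _ _ hx hw).2.1 h
    have : w = (if x = 0 then n - 1 else x - 1) ∨ w = (if x + 1 = n then 0 else x + 1) := by
      split_ifs <;> omega
    rcases this with h | h
    · exact Or.inl (congrArg C h)
    · exact Or.inr (congrArg C h)

/-- Every chordless cycle of a theta graph consists of two branches. -/
theorem IsTheta.allHoles {r : ℕ} {F : ℕ → ℕ → V} (hF : G.IsTheta k r F) (hk : 2 ≤ k)
    (hu : branchSet k r F = Set.univ) : G.AllHoles k := by
  classical
  intro n C hn hC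
  let S : Set V := {z | ∃ x < n, C x = z}
  have hcoord : ∀ z, ∃ i s, i < r ∧ s ≤ k ∧ F i s = z := fun z =>
    (hu ▸ Set.mem_univ z : z ∈ branchSet k r F)
  have hnbr : ∀ z ∈ S, ∃ y ∈ S, ∃ w ∈ S, y ≠ w ∧ G.Adj z y ∧ G.Adj z w ∧
      ∀ t ∈ S, G.Adj z t → t = y ∨ t = w := by
    rintro _ ⟨x, hx, rfl⟩
    obtain ⟨y, z, hy, hz, hyz, h1, h2, h3⟩ := hC.exists_neighbors hn hx
    refine ⟨C y, ⟨y, hy, rfl⟩, C z, ⟨z, hz, rfl⟩, hyz, h1, h2, ?_⟩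
    rintro _ ⟨w, hw, rfl⟩ h
    exact h3 w hw h
  have hinner : ∀ i s, i < r → 0 < s → s < k → ∀ z, G.Adj (F i s) z →
      z = F i (s - 1) ∨ z = F i (s + 1) := by
    intro i s hi hs hsk z h
    obtain ⟨j, t, hj, ht, rfl⟩ := hcoord z
    have h1 := (hF i j s t hi hj hsk.le ht).2.1 h
    have h2 := (hF j i t t hj hi ht ht).1.2 ⟨rfl, by omega⟩
    rw [h2]
    rcases h1.1 with h3 | h3
    · exact Or.inr (by rw [← h3])
    · exact Or.inl (by rw [← h3]; rfl)
  -- An interior vertex of a branch has only two neighbours, and a hole through it needs both.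
  have hboth : ∀ i s, i < r → 0 < s → s < k → F i s ∈ S →
      F i (s - 1) ∈ S ∧ F i (s + 1) ∈ S := by
    intro i s hi hs hsk hS
    obtain ⟨y, hy, w, hw, hyw, h1, h2, -⟩ := hnbr _ hS
    rcases hinner i s hi hs hsk y h1 with rfl | rfl <;>
      rcases hinner i s hi hs hsk w h2 with rfl | rfl
    · exact absurd rfl hyw
    · exact ⟨hy, hw⟩
    · exact ⟨hw, hy⟩
    · exact absurd rfl hyw
  -- The bound `s < k` is essential: the base point `F i k` lies on every branch, so its membership
  -- says nothing about branch `i`.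
  have hdown : ∀ i s, i < r → s < k → F i s ∈ S → ∀ t ≤ s, F i t ∈ S := by
    intro i s hi hsk hS t hts
    induction s with
    | zero => obtain rfl : t = 0 := by omega
              exact hS
    | succ s ih =>
      rcases eq_or_lt_of_le hts with rfl | h
      · exact hS
      · exact ih (by omega) (hboth i (s + 1) hi (by omega) hsk hS).1 (by omega)
  have hup : ∀ i, i < r → F i 1 ∈ S → ∀ t, 1 ≤ t → t ≤ k → F i t ∈ S := by
    intro i hi hS t h1
    induction t, h1 using Nat.le_induction with
    | base => exact fun _ => hS
    | succ t h1 ih => exact fun ht => (hboth i t hi h1 ht (ih (by omega))).2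
  have hbranch : ∀ i, i < r → F i 1 ∈ S → ∀ t ≤ k, F i t ∈ S := by
    intro i hi hS t ht
    rcases Nat.eq_zero_or_pos t with rfl | h
    · exact hdown i 1 hi (by omega) hS 0 (by omega)
    · exact hup i hi hS t h ht
  have hone : ∀ i s, i < r → 0 < s → s < k → F i s ∈ S → F i 1 ∈ S :=
    fun i s hi hs hsk hS => hdown i s hi hsk hS 1 hs
  -- Base points are not adjacent, so one of two consecutive vertices of the hole is interior to a
  -- branch.
  obtain ⟨i₀, hi₀, hS₀⟩ : ∃ i < r, F i 1 ∈ S := by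
    obtain ⟨i, s, hi, hs, h0⟩ := hcoord (C 0)
    obtain ⟨j, t, hj, ht, h1⟩ := hcoord (C 1)
    have hadj : G.Adj (F i s) (F j t) := by
      rw [h0, h1]
      exact (hC 0 1 (by omega) (by omega)).2.2 (Or.inl rfl)
    rw [(hF i j s t hi hj hs ht).2] at hadj
    by_cases h : 0 < s ∧ s < k
    · exact ⟨i, hi, hone i s hi h.1 h.2 ⟨0, by omega, h0.symm⟩⟩
    · exact ⟨j, hj, hone j t hj (by omega) (by omega) ⟨1, by omega, h1.symm⟩⟩
  have hu0 := hbranch i₀ hi₀ hS₀ 0 (by omega)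
  have hzero : ∀ i j, i < r → j < r → F i 0 = F j 0 := fun i j hi hj =>
    (hF i j 0 0 hi hj (by omega) (by omega)).1.2 (by simp)
  have hlast : ∀ i j, i < r → j < r → F i k = F j k := fun i j hi hj =>
    (hF i j k k hi hj le_rfl le_rfl).1.2 (by simp)
  obtain ⟨y, hy, w, hw, hyw, h1, h2, h3⟩ := hnbr _ hu0
  have hbase : ∀ z, G.Adj (F i₀ 0) z → ∃ j < r, z = F j 1 := by
    intro z h
    obtain ⟨j, t, hj, ht, rfl⟩ := hcoord z
    have := (hF i₀ j 0 t hi₀ hj (by omega) ht).2.1 h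
    exact ⟨j, hj, by rw [show t = 1 by omega]⟩
  obtain ⟨i, hi, rfl⟩ := hbase y h1
  obtain ⟨j, hj, rfl⟩ := hbase w h2
  have hij : i ≠ j := by rintro rfl; exact hyw rfl
  have hθ := hF.isHoleSeq hk hi hj hij
  -- The base point has exactly two neighbours in the hole, so exactly two branches are used.
  -- Equality of vertex sets then gives equality of lengths by counting.
  have himage : (Finset.range n).image C = (Finset.range (2 * k)).image (thetaCycle k F i j) := by
    ext z
    simp only [Finset.mem_image, Finset.mem_range]
    constructor
    · intro hz
      obtain ⟨l, t, hl, ht, rfl⟩ := hcoord z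
      rcases Nat.eq_zero_or_pos t with rfl | h0
      · exact ⟨0, by omega, by simpa [thetaCycle] using hzero i l hi hl⟩
      rcases eq_or_lt_of_le ht with rfl | h1
      · exact ⟨t, by omega, by simpa [thetaCycle] using hlast i l hi hl⟩
      have h4 := h3 _ (hone l t hl h0 h1 hz)
        ((hF i₀ l 0 1 hi₀ hl (by omega) (by omega)).2.2 (by simp))
      rcases h4 with h4 | h4
      · obtain rfl : l = i := by
          have := (hF l i 1 1 hl hi (by omega) (by omega)).1.1 h4
          omega
        exact ⟨t, by omega, by rw [thetaCycle, if_pos ht]⟩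
      · obtain rfl : l = j := by
          have := (hF l j 1 1 hl hj (by omega) (by omega)).1.1 h4
          omega
        refine ⟨2 * k - t, by omega, ?_⟩
        rw [thetaCycle, if_neg (by omega)]
        congr 1
        omega
    · rintro ⟨x, hx, rfl⟩
      unfold thetaCycle
      split_ifs with h
      · exact hbranch i hi hy x h
      · exact hbranch j hj hw _ (by omega)
  have hcard := congrArg Finset.card himage
  rwa [Finset.card_image_of_injOn, Finset.card_image_of_injOn, Finset.card_range,
    Finset.card_range] at hcard
  · intro x hx y hy h
    exact (hθ x y (by simpa using hx) (by simpa using hy)).1 h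
  · intro x hx y hy h
    exact (hC x y (by simpa using hx) (by simpa using hy)).1 h

theorem thetaGraph_allHoles {r : ℕ} (hr : 0 < r) (hk : 2 ≤ k) : (thetaGraph r k).AllHoles k :=
  (isTheta_thetaCoord hk).allHoles hk (Set.eq_univ_of_forall fun z => exists_thetaCoord_eq hr hk z)

end

theorem IsThetaCliqueSum.allHoles {V : Type u} {G : SimpleGraph V} {k : ℕ} (hk : 2 ≤ k)
    (h : IsThetaCliqueSum k G) : G.AllHoles k := by
  induction h with
  | theta G r hr hG =>
    obtain ⟨e⟩ := hG
    exact (thetaGraph_allHoles (by omega) hk).of_embedding e.toEmbedding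
  | sum G₁ G₂ G _ _ hG ih₁ ih₂ => exact hG.allHoles ih₁ ih₂

/-! ### Cycle walks versus sequences, and blocks containing holes -/

section
variable {V : Type*} {G : SimpleGraph V} {k : ℕ}

theorem exists_walk_of_seq (C : ℕ → V) (n : ℕ) (h : ∀ i < n, G.Adj (C i) (C (i + 1))) :
    ∃ p : G.Walk (C 0) (C n), p.support = (List.range (n + 1)).map C ∧
      p.edges = (List.range n).map fun i => s(C i, C (i + 1)) := by
  induction n with
  | zero => exact ⟨Walk.nil, by simp, by simp⟩
  | succ n ih =>
    obtain ⟨p, h1, h2⟩ := ih fun i hi => h i (by omega)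
    refine ⟨p.concat (h n (by omega)), ?_, ?_⟩
    · rw [Walk.support_concat, h1, List.range_succ (n := n + 1)]
      simp
    · rw [Walk.edges_concat, h2, List.range_succ (n := n)]
      simp

theorem allHoles_of_forall_isChordless
    (hG : ∀ (v : V) (c : G.Walk v v), c.IsCycle → c.IsChordless → c.length = 2 * k) :
    G.AllHoles k := by
  intro n C hn hC
  obtain ⟨p, hs, he⟩ := exists_walk_of_seq (G := G) C (n - 1) fun i hi =>
    (hC i (i + 1) (by omega) (by omega)).2.2 (Or.inl rfl)
  rw [show n - 1 + 1 = n by omega] at hs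
  have hadj : G.Adj (C (n - 1)) (C 0) := (hC _ _ (by omega) (by omega)).2.2 (by omega)
  have hlen : p.length = n - 1 := by rw [← Walk.length_edges, he]; simp
  have hedge : ∀ x, x + 1 < n → s(C x, C (x + 1)) ∈ p.edges := fun x hx => by
    rw [he, List.mem_map]
    exact ⟨x, List.mem_range.2 (by omega), rfl⟩
  -- The closing edge is put first, so that being a cycle reduces to `p` being a path that does not
  -- use this edge.
  have hc := hG _ (Walk.cons hadj p) ?_ ?_
  · rw [Walk.length_cons, hlen] at hc
    omega
  · rw [Walk.cons_isCycle_iff, Walk.isPath_def, hs, he]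
    refine ⟨List.Nodup.map_on (fun x hx y hy h => ?_) List.nodup_range, fun h => ?_⟩
    · exact (hC x y (List.mem_range.1 hx) (List.mem_range.1 hy)).1 h
    · obtain ⟨i, hi, h⟩ := List.mem_map.1 h
      have hi := List.mem_range.1 hi
      rcases Sym2.eq_iff.1 h with h | h
      · have := (hC _ _ (by omega) (by omega)).1 h.1
        omega
      · have h1 := (hC _ _ (by omega) (by omega)).1 h.1
        have h2 := (hC _ _ (by omega) (by omega)).1 h.2
        omega
  · rw [Walk.isChordless_iff_forall_mem_edges]
    have hmem : ∀ z ∈ (Walk.cons hadj p).support, ∃ x < n, C x = z := by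
      intro z hz
      rw [Walk.support_cons, hs, List.mem_cons] at hz
      rcases hz with rfl | hz
      · exact ⟨n - 1, by omega, rfl⟩
      · obtain ⟨x, hx, rfl⟩ := List.mem_map.1 hz
        exact ⟨x, List.mem_range.1 hx, rfl⟩
    intro z w hz hw h
    obtain ⟨x, hx, rfl⟩ := hmem z hz
    obtain ⟨y, hy, rfl⟩ := hmem w hw
    rw [Walk.edges_cons, List.mem_cons]
    rcases (hC x y hx hy).2.1 h with rfl | rfl | ⟨rfl, h⟩ | ⟨rfl, h⟩
    · exact Or.inr (hedge x hy)
    · exact Or.inr (Sym2.eq_swap ▸ hedge y hx)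
    · left
      rw [show y = n - 1 by omega]
      exact Sym2.eq_swap
    · left
      rw [show x = n - 1 by omega]

theorem Walk.IsCycle.isHoleSeq {v : V} {c : G.Walk v v} (hc : c.IsCycle) (h : c.IsChordless) :
    G.IsHoleSeq c.length c.getVert := by
  have hlen := hc.three_le_length
  have hinj : ∀ x y, x < c.length → y < c.length → c.getVert x = c.getVert y → x = y :=
    fun x y hx hy h => hc.getVert_injOn' (show x ≤ c.length - 1 by omega)
      (show y ≤ c.length - 1 by omega) h
  have hclose : c.getVert c.length = c.getVert 0 := by simp
  have hnext : ∀ i x, i < c.length → x < c.length → c.getVert (i + 1) = c.getVert x →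
      i + 1 = x ∨ (x = 0 ∧ i + 1 = c.length) := by
    intro i x hi hx h
    rcases eq_or_lt_of_le (show i + 1 ≤ c.length from hi) with h' | h'
    · rw [h', hclose] at h
      exact Or.inr ⟨(hinj _ _ (by omega) hx h).symm, h'⟩
    · exact Or.inl (hinj _ _ h' hx h)
  refine fun x y hx hy => ⟨hinj x y hx hy, fun hadj => ?_, ?_⟩
  · have := h.mem_edges (c.getVert_mem_support x) (c.getVert_mem_support y) hadj
    obtain ⟨i, hi, h⟩ := (c.mk_mem_edges_iff_exists).1 this
    rcases Sym2.eq_iff.1 h with h | h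
    · have h1 := hinj _ _ hi hx h.1
      have h2 := hnext _ _ hi hy h.2
      omega
    · have h1 := hinj _ _ hi hy h.1
      have h2 := hnext _ _ hi hx h.2
      omega
  · rintro (rfl | rfl | ⟨rfl, h⟩ | ⟨rfl, h⟩)
    · exact c.adj_getVert_succ hx
    · exact (c.adj_getVert_succ hy).symm
    · have := c.adj_getVert_succ hy
      rw [h, hclose] at this
      exact this.symm
    · have := c.adj_getVert_succ hx
      rwa [h, hclose] at this

theorem IsHoleSeq.exists_segment {n : ℕ} {C : ℕ → V} (hC : G.IsHoleSeq n C) {i j z : ℕ}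
    (hij : i ≤ j) (hj : j < n) (hz : z < n) (hzij : z < i ∨ j < z) :
    ∃ p : G.Walk (C i) (C j), C z ∉ p.support := by
  obtain ⟨p, hp, -⟩ := exists_walk_of_seq (G := G) (fun t => C (i + t)) (j - i) fun t ht =>
    (hC (i + t) (i + (t + 1)) (by omega) (by omega)).2.2 (Or.inl rfl)
  have h0 : C (i + 0) = C i := rfl
  have h1 : C (i + (j - i)) = C j := by rw [show i + (j - i) = j by omega]
  refine ⟨p.copy h0 h1, ?_⟩
  rw [Walk.support_copy, hp, List.mem_map]
  rintro ⟨t, ht, h⟩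
  have ht := List.mem_range.1 ht
  have := (hC _ _ (by omega) hz).1 h
  omega

/-- If the deleted vertex lies between the two given ones, go round the other way, through the edge
joining the last index to index 0. -/
theorem IsHoleSeq.avoids {n : ℕ} {C : ℕ → V} (hC : G.IsHoleSeq n C) (hn : 3 ≤ n)
    (hcover : ∀ z, ∃ x < n, C x = z) : G.Avoids := by
  have key : ∀ x y z, x ≤ y → y < n → z < n → x ≠ z → y ≠ z →
      ∃ p : G.Walk (C x) (C y), C z ∉ p.support := by
    intro x y z hxy hy hz hxz hyz
    by_cases h : z < x ∨ y < z
    · exact hC.exists_segment hxy hy hz h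
    · obtain ⟨p, hp⟩ := hC.exists_segment (i := 0) (j := x) (z := z) (by omega) (by omega) hz
        (by omega)
      obtain ⟨q, hq⟩ := hC.exists_segment (i := y) (j := n - 1) (z := z) (by omega) (by omega) hz
        (by omega)
      have hadj : G.Adj (C 0) (C (n - 1)) := (hC _ _ (by omega) (by omega)).2.2 (by omega)
      refine ⟨p.reverse.append (Walk.cons hadj q.reverse), fun h => ?_⟩
      rw [Walk.mem_support_append_iff, Walk.support_cons, List.mem_cons, Walk.support_reverse,
        Walk.support_reverse, List.mem_reverse, List.mem_reverse] at h
      rcases h with h | h | h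
      · exact hp h
      · exact hp (by rw [h]; exact p.start_mem_support)
      · exact hq h
  intro v x y hx hy
  obtain ⟨z, hz, rfl⟩ := hcover v
  obtain ⟨i, hi, rfl⟩ := hcover x
  obtain ⟨j, hj, rfl⟩ := hcover y
  have hiz : i ≠ z := by rintro rfl; exact hx rfl
  have hjz : j ≠ z := by rintro rfl; exact hy rfl
  rcases le_total i j with h | h
  · exact key i j z h hj hz hiz hjz
  · obtain ⟨p, hp⟩ := key j i z h hi hz hjz hiz
    exact ⟨p.reverse, by simpa using hp⟩

theorem Avoids.connected (hG : G.Avoids) (h3 : ∃ a b c : V, a ≠ b ∧ a ≠ c ∧ b ≠ c) :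
    G.Connected := by
  obtain ⟨a, b, c, hab, hac, hbc⟩ := h3
  have : Nonempty V := ⟨a⟩
  refine ⟨fun x y => ?_⟩
  obtain ⟨v, hx, hy⟩ : ∃ v, x ≠ v ∧ y ≠ v := by
    by_contra hcon
    push Not at hcon
    have ha := hcon a
    have hb := hcon b
    have hc := hcon c
    by_cases h1 : x = a
    · exact hbc ((hb (h1 ▸ hab)).symm.trans (hc (h1 ▸ hac)))
    by_cases h2 : x = b
    · exact hac ((ha h1).symm.trans (hc (h2 ▸ hbc)))
    · exact hab ((ha h1).symm.trans (hb h2))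
  exact ⟨(hG v x y hx hy).choose⟩

theorem Avoids.of_bijective {W : Type*} {G' : SimpleGraph W} (hG : G.Avoids) (f : G →g G')
    (hf : Function.Bijective f) : G'.Avoids := by
  intro v x y hx hy
  obtain ⟨v, rfl⟩ := hf.2 v
  obtain ⟨x, rfl⟩ := hf.2 x
  obtain ⟨y, rfl⟩ := hf.2 y
  obtain ⟨p, hp⟩ := hG v x y (fun h => hx (congrArg f h)) (fun h => hy (congrArg f h))
  refine ⟨p.map f, fun h => hp ?_⟩
  rw [Walk.support_map, List.mem_map] at h
  obtain ⟨z, hz, h⟩ := h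
  rwa [← hf.1 h]

/-- Adding all edges of `G` between the vertices of `B` creates no cut vertex, so by maximality they
are already in `B`. -/
theorem IsBlock.adj_iff {B : G.Subgraph} (hB : G.IsBlock B) (hbi : B.coe.IsBiconnected) {x y : V}
    (hx : x ∈ B.verts) (hy : y ∈ B.verts) : B.Adj x y ↔ G.Adj x y := by
  refine ⟨fun h => B.adj_sub h, fun h => ?_⟩
  have hle : B ≤ (⊤ : G.Subgraph).induce B.verts := B.le_induce_top_verts
  have hbij : Function.Bijective (Subgraph.inclusion hle) :=
    ⟨Subgraph.inclusion.injective hle, fun z => ⟨⟨z, z.2⟩, rfl⟩⟩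
  have hav := (hbi.1.avoids hbi.2.1).of_bijective (Subgraph.inclusion hle) hbij
  obtain ⟨a, b, c, hab, hac, hbc⟩ := hbi.2.2
  have hcon := hav.connected ⟨_, _, _, hbij.1.ne hab, hbij.1.ne hac, hbij.1.ne hbc⟩
  have := hB.2 ⟨hcon, fun v => hav.not_isCutVertex v⟩ hle
  exact this.2 ⟨hx, hy, h⟩

/-- The subgraph induced on the hole is connected without cut vertices, and by finiteness it extends
to a maximal such subgraph. -/
theorem IsHoleSeq.exists_block [Finite V] {n : ℕ} {C : ℕ → V} (hC : G.IsHoleSeq n C)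
    (hn : 3 ≤ n) : ∃ B : G.Subgraph, G.IsBlock B ∧ B.coe.IsBiconnected ∧
      ∃ D, B.coe.IsHoleSeq n D := by
  let S : Set V := {z | ∃ x < n, C x = z}
  let B₀ : G.Subgraph := (⊤ : G.Subgraph).induce S
  -- A subgraph above `B₀` contains every edge of the hole, and it has no edges outside `G`, so the
  -- hole stays chordless in it.
  have lift : ∀ B : G.Subgraph, B₀ ≤ B → ∃ D : ℕ → B.verts, (∀ x < n, (D x : V) = C x) ∧
      B.coe.IsHoleSeq n D := by
    intro B hle
    have hmem : ∀ x < n, C x ∈ B.verts := fun x hx => hle.1 ⟨x, hx, rfl⟩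
    let D : ℕ → B.verts := fun x =>
      if h : x < n then ⟨C x, hmem x h⟩ else ⟨C 0, hmem 0 (by omega)⟩
    have hD : ∀ x < n, (D x : V) = C x := fun x hx => by simp [D, hx]
    refine ⟨D, hD, fun x y hx hy => ⟨fun h => (hC x y hx hy).1 ?_, ?_⟩⟩
    · rw [← hD x hx, ← hD y hy, h]
    · rw [← (hC x y hx hy).2, Subgraph.coe_adj, hD x hx, hD y hy]
      exact ⟨fun h => B.adj_sub h, fun h => hle.2 ⟨⟨x, hx, rfl⟩, ⟨y, hy, rfl⟩, h⟩⟩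
  have three : ∀ B : G.Subgraph, B₀ ≤ B → ∃ a b c : B.verts, a ≠ b ∧ a ≠ c ∧ b ≠ c := by
    intro B hle
    obtain ⟨D, -, hD⟩ := lift B hle
    refine ⟨D 0, D 1, D 2, fun h => ?_, fun h => ?_, fun h => ?_⟩
    · have := (hD 0 1 (by omega) (by omega)).1 h; omega
    · have := (hD 0 2 (by omega) (by omega)).1 h; omega
    · have := (hD 1 2 (by omega) (by omega)).1 h; omega
  obtain ⟨D₀, hD₀, hhole⟩ := lift B₀ le_rfl
  have hav : B₀.coe.Avoids := by
    refine hhole.avoids hn ?_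
    rintro ⟨_, x, hx, rfl⟩
    exact ⟨x, hx, Subtype.ext (hD₀ x hx)⟩
  obtain ⟨B, hle, hB⟩ := Finite.exists_le_maximal
    (p := fun H : G.Subgraph => H.coe.Connected ∧ ∀ v : H.verts, ¬ H.coe.IsCutVertex v)
    (a := B₀) ⟨hav.connected (three B₀ le_rfl), fun v => hav.not_isCutVertex v⟩
  obtain ⟨D, -, hD⟩ := lift B hle
  exact ⟨B, hB, ⟨hB.1.1, hB.1.2, three B hle⟩, D, hD⟩

end
end SimpleGraph

theorem theorem5p7 {V : Type*} [Finite V] (G : SimpleGraph V) (k : ℕ) (hk : 3 ≤ k) :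
    (∀ (v : V) (c : G.Walk v v), c.IsCycle → c.IsChordless → c.length = 2 * k) ↔
      (∀ B : G.Subgraph, G.IsBlock B → B.coe.IsBiconnected →
        SimpleGraph.IsThetaCliqueSum k B.coe) := by
  constructor
  · intro h B hB hbi
    refine (hbi.1.avoids hbi.2.1).isThetaCliqueSum hk hbi.2.2
      ((SimpleGraph.allHoles_of_forall_isChordless h).of_embedding
        ⟨Function.Embedding.subtype _, fun {x y} => ?_⟩)
    exact (hB.adj_iff hbi x.2 y.2).symm
  · intro h v c hc hcl
    have hlen := hc.three_le_length
    obtain ⟨B, hB, hbi, D, hD⟩ := (hc.isHoleSeq hcl).exists_block hlen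
    exact (h B hB hbi).allHoles (by omega) _ D hlen hD
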